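/- **Setting.** Let $M$ be a Riemann surface and let $\mathbb{H}^2$ be regarded as a quaternionic right vector space. Smooth maps $f\colon M\to S^4=\mathbb{HP}^1$ are identified with smooth quaternionic line subbundles $L$ of the trivial bundle $V=M\times\mathbb{H}^2$ with its trivial connection $\nabla$. Let $\pi\colon V\to V/L$ be the projection and $\delta=\pi\nabla|_L\in\Omega^1(\mathrm{Hom}(L,V/L))$ the derivative of $f$; for a 1-form $\omega$ put $(*\omega)(X)=\omega(iX)$. The map $f$ is a conformal immersion if $\delta$ vanishes nowhere and there are complex structures $J$ on $L$ and $\tilde J$ on $V/L$ with $*\delta=\delta J=\tilde J\delta$. Its mean curvature sphere congruence is the unique $S\in\Gamma(\mathrm{End}(V))$ with $S^2=-1$, $SL=L$, $*\delta=S\delta=\delta S$ and $Q|_L=0$, where $$A=\tfrac14(S\nabla S+*\nabla S),\qquad Q=\tfrac14(S\nabla S-*\nabla S).$$ A conformal immersion $f$ is called *constrained Willmore* if there is a smooth 1-form $\eta$ with values in $\mathcal R=\{B\in\mathrm{End}(V): \mathrm{im}\,B\subset L\subset\ker B\}$ such that $d^\nabla(2{*}A+\eta)=0$, and *Willmore*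 if $d^\nabla{*}A=0$ (the Euler–Lagrange equations). Given such an $\eta$, let $A_\circ$ be defined by $2{*}A_\circ=2{*}A+\eta$. For $\mu\in\mathbb{C}\setminus\{0\}$ let $$\nabla^\mu=\nabla+(\mu-1)\tfrac{1-iS}{2}A_\circ+(\mu^{-1}-1)\tfrac{1+iS}{2}A_\circ ,$$ a complex connection on $V$, where complex scalars (in particular $i$) act on $V$ by right multiplication. A map $f^\sharp\colon M\to S^4$ with line bundle $L^\sharp$ is a *$\nabla^\mu$-Darboux transform* of $f$ if there is $\mu\in\mathbb{C}\setminus\{0\}$ such that $L^\sharp$ is locally of the form $L^\sharp=\psi\mathbb{H}$ with $\psi$ a smooth local section of $V$ satisfying $\nabla^\mu\psi=0$ whose projection to $V/L$ vanishes nowhere. **Theorem.** Let $f\colon M\to S^4$ be a constrained Willmore immersion of a Riemann surface $M$, let $\eta$ be any 1-form as above, and let $f^\sharp\colon M\to S^4$ be a $\nabla^\mu$-Darboux transform of $f$, for $\nabla^\mu$ defined with this $\eta$. Then the set $U\subset M$ of points over which $f^\sharp$ is immersed is open, and $f^\sharp|_U$ is again a constrained Willmore immersion. If $f$ is Willmore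 and $\nabla^\mu$ is taken with $\eta\equiv 0$, then $f^\sharp|_U$ is again a Willmore immersion. -/

import Mathlib

open Set Filter Topology
open scoped Manifold ContDiff Quaternion

noncomputable section

namespace QuaternionicSurface

/-- The quaternionic right vector space `ℍ²`; the trivial bundle `V` is `M × V`. -/
abbrev V : Type := Fin 2 → ℍ

/-- Real linear endomorphisms of `ℍ²`. Quaternionic linear ones are singled out by
`IsQuaternionic`. -/
abbrev EndV : Type := V →L[ℝ] V

/-- The 4-sphere as the quaternionic projective line: the quaternionic lines in the right
vector space `ℍ²`. -/
abbrev HP1 : Type := Projectivization ℍᵐᵒᵖ V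

/-- Right multiplication `v ↦ v a` by a quaternion `a`. -/
def rightMul (a : ℍ) : EndV :=
  LinearMap.toContinuousLinearMap
    { toFun := fun v k => v k * a
      map_add' := fun v w => by ext1 k; simp [add_mul]
      map_smul' := fun r v => by ext1 k; simp }

/-- Linearity with respect to quaternionic scalars, which act from the right. -/
def IsQuaternionic (B : EndV) : Prop :=
  ∀ (v : V) (a : ℍ), B (rightMul a v) = rightMul a (B v)

variable {M : Type*} [TopologicalSpace M] [ChartedSpace ℂ M]

/-! ### Calculus on a Riemann surface -/

/-- The real tangent space at `p`. -/
abbrev Tan (p : M) : Type := TangentSpace 𝓘(ℝ, ℂ) p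

/-- The complex structure `X ↦ iX` of the tangent space. It is computed in the preferred chart
at `p`, and is independent of the chart because coordinate changes are holomorphic. -/
def tanJ (p : M) : Tan p →L[ℝ] Tan p :=
  (ContinuousLinearMap.mul ℝ ℂ Complex.I : ℂ →L[ℝ] ℂ)

/-- One-forms on `M` with values in the real vector space `E`. -/
abbrev OneForm (M : Type*) [TopologicalSpace M] [ChartedSpace ℂ M] (E : Type*)
    [NormedAddCommGroup E] [NormedSpace ℝ E] : Type _ :=
  (p : M) → Tan p →L[ℝ] E

section Forms

variable {E : Type*} [NormedAddCommGroup E] [NormedSpace ℝ E]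

/-- `(⋆α)(X) = α(iX)`. -/
def starForm (α : OneForm M E) : OneForm M E := fun p => (α p).comp (tanJ p)

/-- The differential of a vector valued function, i.e. its derivative with respect to the
trivial connection. -/
def diff (F : M → E) : OneForm M E := fun p => mfderiv 𝓘(ℝ, ℂ) 𝓘(ℝ, E) F p

/-- The coordinate expression of a one-form in a chart `e` (its pull-back by `e⁻¹`). -/
def inChart (e : OpenPartialHomeomorph M ℂ) (α : OneForm M E) (z : ℂ) : ℂ →L[ℝ] E :=
  (α (e.symm z)).comp (mfderiv 𝓘(ℝ, ℂ) 𝓘(ℝ, ℂ) e.symm z)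

/-- The one-form `α` is smooth on the open set `U`. -/
def IsSmoothFormOn (α : OneForm M E) (U : Set M) : Prop :=
  ∀ e ∈ atlas ℂ M, ContDiffOn ℝ ∞ (inChart e α) (e.target ∩ e.symm ⁻¹' U)

/-- `dα = 0` on the open set `U`: in each chart of the atlas, with coordinate `x + iy`,
`∂ₓ α(∂_y) = ∂_y α(∂ₓ)`. -/
def IsClosedFormOn (α : OneForm M E) (U : Set M) : Prop :=
  ∀ e ∈ atlas ℂ M, ∀ z ∈ e.target ∩ e.symm ⁻¹' U,
    fderiv ℝ (inChart e α) z 1 Complex.I = fderiv ℝ (inChart e α) z Complex.I 1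

end Forms

/-! ### Surfaces in the 4-sphere as line subbundles of `V` -/

/-- The fibre `L_p ⊂ ℍ²` of the line subbundle corresponding to `f`. -/
abbrev line (f : M → HP1) (p : M) : Submodule ℍᵐᵒᵖ V := (f p).submodule

/-- `φ` is, near `p`, a smooth section of the line subbundle `L`. -/
def IsSectionNear (f : M → HP1) (p : M) (φ : M → V) : Prop :=
  ∀ᶠ q in 𝓝 p, ContMDiffAt 𝓘(ℝ, ℂ) 𝓘(ℝ, V) ∞ φ q ∧ φ q ∈ line f q

/-- `f` is smooth on `U`: near each point of `U` the bundle `L` has a smooth section without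
zeros. -/
def IsSmoothMapOn (f : M → HP1) (U : Set M) : Prop :=
  ∀ p ∈ U, ∃ φ : M → V, IsSectionNear f p φ ∧ φ p ≠ 0

/-- The derivative `δ ∈ Ω¹(Hom(L, V/L))`, `δφ = π ∇φ` for sections `φ` of `L`, is injective at
`p`: if `δ(X) = 0` then `X = 0`. -/
def IsImmersedAt (f : M → HP1) (p : M) : Prop :=
  ∀ X : Tan p, (∀ φ : M → V, IsSectionNear f p φ → diff φ p X ∈ line f p) → X = 0

/-- The points over which `f` is immersed. -/
def immersedSet (f : M → HP1) : Set M := {p | IsImmersedAt f p}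

/-- `f` is a conformal immersion on `U`: it is smooth, immersed, and there are complex structures
`J` on `L` and `J'` on `V/L` with `⋆δ = δ J = J' δ`. (`J` and `J'` are unique where `f` is
immersed, and therefore automatically smooth.) -/
structure IsConformalImmersionOn (f : M → HP1) (U : Set M) : Prop where
  smooth : IsSmoothMapOn f U
  immersed : ∀ p ∈ U, IsImmersedAt f p
  conformal : ∀ p ∈ U, ∃ (J : line f p →ₗ[ℍᵐᵒᵖ] line f p)
      (J' : (V ⧸ line f p) →ₗ[ℍᵐᵒᵖ] (V ⧸ line f p)),
    (∀ v, J (J v) = -v) ∧ (∀ w, J' (J' w) = -w) ∧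
    (∀ φ χ : M → V, IsSectionNear f p φ → IsSectionNear f p χ →
      (∀ hv : φ p ∈ line f p, χ p = J ⟨φ p, hv⟩) → ∀ X : Tan p,
        (line f p).mkQ (diff φ p (tanJ p X)) = (line f p).mkQ (diff χ p X)) ∧
    (∀ φ : M → V, IsSectionNear f p φ → ∀ X : Tan p,
        (line f p).mkQ (diff φ p (tanJ p X)) = J' ((line f p).mkQ (diff φ p X)))

/-! ### Hopf fields and the mean curvature sphere congruence -/

/-- The Hopf field `A = (S ∇S + ⋆∇S) / 4`. -/
def hopfA (S : M → EndV) : OneForm M EndV := fun p =>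
  (1 / 4 : ℝ) • ((ContinuousLinearMap.compL ℝ V V V (S p)).comp (diff S p) + starForm (diff S) p)

/-- The Hopf field `Q = (S ∇S - ⋆∇S) / 4`. -/
def hopfQ (S : M → EndV) : OneForm M EndV := fun p =>
  (1 / 4 : ℝ) • ((ContinuousLinearMap.compL ℝ V V V (S p)).comp (diff S p) - starForm (diff S) p)

/-- `S` is the mean curvature sphere congruence of `f` on the open set `U`: a smooth section of
`End(V)` with `S² = -1`, `S L = L`, `⋆δ = S δ = δ S` and `Q|_L = 0`. -/
structure IsMeanCurvatureSphereOn (f : M → HP1) (S : M → EndV) (U : Set M) : Prop where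
  smooth : ContMDiffOn 𝓘(ℝ, ℂ) 𝓘(ℝ, EndV) ∞ S U
  quaternionic : ∀ p ∈ U, IsQuaternionic (S p)
  sq : ∀ p ∈ U, ∀ v, S p (S p v) = -v
  maps_line : ∀ p ∈ U, ∀ v ∈ line f p, S p v ∈ line f p
  star_eq_left : ∀ p ∈ U, ∀ φ : M → V, IsSectionNear f p φ → ∀ X : Tan p,
    diff φ p (tanJ p X) - S p (diff φ p X) ∈ line f p
  star_eq_right : ∀ p ∈ U, ∀ φ : M → V, IsSectionNear f p φ → ∀ X : Tan p,
    diff φ p (tanJ p X) - diff (fun q => S q (φ q)) p X ∈ line f p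
  hopfQ_line : ∀ p ∈ U, ∀ X : Tan p, ∀ v ∈ line f p, hopfQ S p X v = 0

/-! ### Constrained Willmore and Willmore surfaces -/

/-- The fibre at `p` of `R = {B ∈ End(V) | im B ⊂ L ⊂ ker B}`. -/
def IsNilpotentAlong (f : M → HP1) (p : M) (B : EndV) : Prop :=
  IsQuaternionic B ∧ (∀ v, B v ∈ line f p) ∧ ∀ v ∈ line f p, B v = 0

/-- `η ∈ Ω¹(R)` solves the Euler-Lagrange equation `d(2⋆A + η) = 0` on the open set `U`, where `A`
is the Hopf field of the mean curvature sphere congruence `S` of `f`. -/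
structure IsLagrangeMultiplierOn (f : M → HP1) (S : M → EndV) (η : OneForm M EndV) (U : Set M) :
    Prop where
  smooth : IsSmoothFormOn η U
  nilpotent : ∀ p ∈ U, ∀ X : Tan p, IsNilpotentAlong f p (η p X)
  closed : IsClosedFormOn (fun p => (2 : ℝ) • starForm (hopfA S) p + η p) U

/-- `f`, restricted to the open set `U`, is a constrained Willmore immersion. -/
def IsConstrainedWillmoreOn (f : M → HP1) (U : Set M) : Prop :=
  IsConformalImmersionOn f U ∧ ∃ (S : M → EndV) (η : OneForm M EndV),
    IsMeanCurvatureSphereOn f S U ∧ IsLagrangeMultiplierOn f S η U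

/-- `f`, restricted to the open set `U`, is a Willmore immersion: `d ⋆A = 0`. -/
def IsWillmoreOn (f : M → HP1) (U : Set M) : Prop :=
  IsConformalImmersionOn f U ∧ ∃ S : M → EndV,
    IsMeanCurvatureSphereOn f S U ∧ IsClosedFormOn (starForm (hopfA S)) U

/-! ### The associated family and its Darboux transforms -/

/-- The one-form `A_∘` with `2⋆A_∘ = 2⋆A + η`, that is, `A_∘ = A - ⋆η / 2`. -/
def hopfA₀ (S : M → EndV) (η : OneForm M EndV) : OneForm M EndV := fun p =>
  hopfA S p - (1 / 2 : ℝ) • starForm η p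

/-- Multiplication by the complex number `c` on the complex vector space `(ℍ², i)`, whose complex
structure is right multiplication by the quaternion `i`. -/
def cmul (c : ℂ) : EndV := rightMul (c : ℍ)

/-- `A_∘^{(1,0)} = (1 - iS)/2 A_∘`. -/
def hopfA10 (S : M → EndV) (η : OneForm M EndV) (p : M) (X : Tan p) : EndV :=
  (1 / 2 : ℝ) • (hopfA₀ S η p X - cmul Complex.I * S p * hopfA₀ S η p X)

/-- `A_∘^{(0,1)} = (1 + iS)/2 A_∘`. -/
def hopfA01 (S : M → EndV) (η : OneForm M EndV) (p : M) (X : Tan p) : EndV :=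
  (1 / 2 : ℝ) • (hopfA₀ S η p X + cmul Complex.I * S p * hopfA₀ S η p X)

/-- The associated family of connections
`∇^μ ψ = ∇ψ + (μ - 1) A_∘^{(1,0)} ψ + (μ⁻¹ - 1) A_∘^{(0,1)} ψ`, evaluated at `X ∈ T_p M`. -/
def nablaMu (S : M → EndV) (η : OneForm M EndV) (μ : ℂ) (ψ : M → V) (p : M) (X : Tan p) : V :=
  diff ψ p X + cmul (μ - 1) (hopfA10 S η p X (ψ p)) + cmul (μ⁻¹ - 1) (hopfA01 S η p X (ψ p))

/-- `g` is a `∇^μ`-Darboux transform of `f` for some `μ ∈ ℂ \ {0}`, where `∇^μ` is built from the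
mean curvature sphere congruence `S` of `f` and the multiplier `η`: the line bundle of `g` is
locally spanned by a smooth `∇^μ`-parallel section `ψ` of `V` whose projection to `V/L` has no
zeros. -/
def IsNablaMuDarbouxTransform (f : M → HP1) (S : M → EndV) (η : OneForm M EndV) (g : M → HP1) :
    Prop :=
  ∃ μ : ℂ, μ ≠ 0 ∧ ∀ p : M, ∃ ψ : M → V, ∀ᶠ q in 𝓝 p,
    ContMDiffAt 𝓘(ℝ, ℂ) 𝓘(ℝ, V) ∞ ψ q ∧ (∀ X : Tan q, nablaMu S η μ ψ q X = 0) ∧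
      ψ q ∉ line f q ∧ line g q = Submodule.span ℍᵐᵒᵖ {ψ q}

end QuaternionicSurface

end

/-!
Let `ω = 2⋆A + η`, a closed one-form, and let `ψ` be a local `∇^μ`-parallel section. The whole
theorem rests on one factorization and one integration by parts.

* Both `A` and `η` take values in `L`; for `A` this is the dual form of `Q|_L = 0`
  (`SphereAt.hopfA_mem`). Reading `dω = 0` modulo `L` gives `⋆ω = Sω` (`WillmoreFormAt.apply_I`).
  Since `∇S = 2(⋆Q - ⋆A)`, that `η` vanishes on `L` means that `ω + ∇S` does. Conversely, a closed
  form with values in `L` for which `ω + ∇S` vanishes on `L` yields the Lagrange multiplier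
  `η = ω - 2⋆A` (`isLagrangeMultiplierOn_of_chart`).
* As `A_∘ = -½ Sω`, the equation `∇^μ ψ = 0` expresses `dψ` by `ωψ` and `Sωψ`. So `dψ` takes values
  in `L` and `⋆dψ = S dψ = dψ β`, and solving for `ωψ` gives `ωψ = S dψ - dψ c` with a constant `c`
  (`TransformAt.of_parallel`). In particular the line bundle `L♯ = ψℍ` is immersed exactly where
  `dψ ≠ 0`, and there `dψ` spans `L`.
* Hence `ω = dψ y` for a field `y` of quaternionic functionals on `V`, and `ω - d(ψ y) = -ψ dy` is a
  closed form with values in `L♯`. Closedness reads `dψ ∧ dy = 0`, that is, `⋆dy = β dy`.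
* The mean curvature sphere of `L♯` is `S♯ = S + ψ y` on `L` and `S♯ ψ = ψ β`
  (`TransformAt.sphereAt`). Because `y(ψ) = β - c`, one gets `(∇S♯)ψ = ψ (dy ψ)`. By `⋆dy = β dy`
  this is the condition `Q♯ψ = 0`, and it also says that `-ψ dy + ∇S♯` vanishes on `L♯`. So the
  Darboux transform is constrained Willmore (`TransformAt.willmoreFormAt`).
* If `η = 0`, then `ω = 2⋆A` anticommutes with `S`, from which `-ψ dy` anticommutes with `S♯`. A
  multiplier always commutes with the mean curvature sphere (`WillmoreFormAt.multiplier_comm`), so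
  the multiplier of the Darboux transform vanishes. In the Willmore case the congruence with
  `d⋆A = 0` is the given one by uniqueness (`SphereAt.unique`).

All of this is computed in a holomorphic coordinate `x + iy`, where the equations between
one-forms are evaluated at `∂ₓ` and `∂_y`. The endomorphism fields `S♯` and `Y = ψ y` do not depend
on the choice of the parallel section (`global_eq`), and are therefore defined globally.

Quaternionic scalars act from the right: `v <• a` is `v a`.
-/

noncomputable section

namespace QuaternionicSurface

open scoped RightActions


/-! ### Quaternionic linear algebra -/

/-- The quaternionic line `wℍ` spanned by `w`. -/
abbrev hline (w : V) : Submodule ℍᵐᵒᵖ V := Submodule.span ℍᵐᵒᵖ {w}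

/-- The map `(w, a) ↦ w a` as a continuous real bilinear map. -/
def col : V →L[ℝ] ℍ →L[ℝ] V :=
  LinearMap.toContinuousLinearMap
    { toFun := fun w => LinearMap.toContinuousLinearMap
        { toFun := fun a => w <• a
          map_add' := fun a b => by rw [MulOpposite.op_add, add_smul]
          map_smul' := fun r a => by ext1 k; simp }
      map_add' := fun v w => by ext1 a; exact smul_add (MulOpposite.op a) v w
      map_smul' := fun r v => by ext1 a; exact smul_comm (MulOpposite.op a) r v }

@[simp] lemma col_apply (w : V) (a : ℍ) : col w a = w <• a := rfl

/-- Quaternionic conjugation as a continuous real linear map. -/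
def hstar : ℍ →L[ℝ] ℍ :=
  LinearMap.toContinuousLinearMap
    { toFun := star
      map_add' := star_add
      map_smul' := Quaternion.star_smul }

/-- The functional `v ↦ w* v / |w|²`, which sends `w t` to `t`. -/
def hcoord (w : V) : V →L[ℝ] ℍ :=
  ∑ k, (ContinuousLinearMap.mul ℝ ℍ ((∑ j, ‖w j‖ ^ 2)⁻¹ • star (w k))).comp
    (ContinuousLinearMap.proj k)

lemma rightMul_apply (a : ℍ) (v : V) : rightMul a v = v <• a := rfl

lemma smul_hmul (v : V) (a b : ℍ) : (v <• a) <• b = v <• (a * b) := by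
  rw [smul_smul, ← MulOpposite.op_mul]

lemma hmul_add (v : V) (a b : ℍ) : v <• (a + b) = v <• a + v <• b := by
  rw [MulOpposite.op_add, add_smul]

lemma hmul_sub (v : V) (a b : ℍ) : v <• (a - b) = v <• a - v <• b := by
  rw [MulOpposite.op_sub, sub_smul]

lemma hmul_neg (v : V) (a : ℍ) : v <• (-a) = -(v <• a) := by
  rw [MulOpposite.op_neg, neg_smul]

@[simp] lemma hmul_zero (v : V) : v <• (0 : ℍ) = 0 := by
  rw [MulOpposite.op_zero, zero_smul]

@[simp] lemma hmul_one (v : V) : v <• (1 : ℍ) = v := by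
  rw [MulOpposite.op_one, one_smul]

lemma hmul_eq_zero {v : V} {a : ℍ} (hv : v ≠ 0) (h : v <• a = 0) : a = 0 := by
  rcases smul_eq_zero.1 h with h | h
  · simpa using h
  · exact absurd h hv

lemma hmul_left_cancel {v : V} {a b : ℍ} (hv : v ≠ 0) (h : v <• a = v <• b) : a = b := by
  rw [← sub_eq_zero, ← hmul_sub] at h
  exact sub_eq_zero.1 (hmul_eq_zero hv h)

lemma mem_hline {v w : V} : v ∈ hline w ↔ ∃ t : ℍ, v = w <• t := by
  rw [Submodule.mem_span_singleton]
  constructor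
  · rintro ⟨a, rfl⟩
    exact ⟨a.unop, rfl⟩
  · rintro ⟨t, rfl⟩
    exact ⟨_, rfl⟩

lemma hmul_mem_hline (w : V) (t : ℍ) : w <• t ∈ hline w := mem_hline.2 ⟨t, rfl⟩

lemma self_mem_hline (w : V) : w ∈ hline w := Submodule.mem_span_singleton_self w

lemma sum_norm_sq_ne_zero {w : V} (hw : w ≠ 0) : (∑ k, ‖w k‖ ^ 2) ≠ 0 := by
  intro h
  apply hw
  ext1 k
  have := (Finset.sum_eq_zero_iff_of_nonneg (fun i _ => sq_nonneg ‖w i‖)).1 h k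
    (Finset.mem_univ k)
  simpa using this

lemma hcoord_hmul {w : V} (hw : w ≠ 0) (t : ℍ) : hcoord w (w <• t) = t := by
  have h := sum_norm_sq_ne_zero hw
  have h1 : ∀ k, star (w k) * (w k * t) = (‖w k‖ ^ 2) • t := by
    intro k
    rw [← mul_assoc, Quaternion.star_mul_self, Quaternion.normSq_eq_norm_mul_self,
      Quaternion.coe_mul_eq_smul, sq]
  have h2 : hcoord w (w <• t) = (∑ k, ‖w k‖ ^ 2)⁻¹ • ∑ k, star (w k) * (w k * t) := by
    simp [hcoord]
  rw [h2]
  simp_rw [h1]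
  rw [← Finset.sum_smul, smul_smul, inv_mul_cancel₀ h, one_smul]

lemma hmul_hcoord {v w : V} (hw : w ≠ 0) (h : v ∈ hline w) : w <• hcoord w v = v := by
  obtain ⟨t, rfl⟩ := mem_hline.1 h
  rw [hcoord_hmul hw]

lemma hcoord_right (w v : V) (a : ℍ) : hcoord w (v <• a) = hcoord w v * a := by
  simp [hcoord, add_mul, mul_assoc]

lemma contDiffAt_hcoord {w : V} (hw : w ≠ 0) : ContDiffAt ℝ ∞ hcoord w := by
  have h := sum_norm_sq_ne_zero hw
  unfold hcoord
  have hs : ∀ k : Fin 2, ContDiffAt ℝ ∞ (fun v : V => star (v k)) w := fun k =>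
    (hstar.comp
      (ContinuousLinearMap.proj (R := ℝ) (φ := fun _ : Fin 2 => ℍ) k)).contDiff.contDiffAt
  have hn : ∀ k : Fin 2, ContDiffAt ℝ ∞ (fun v : V => ‖v k‖ ^ 2) w := fun k =>
    (ContDiff.norm_sq ℝ (contDiff_apply ℝ ℍ k)).contDiffAt
  have hc : ∀ k : Fin 2, ContDiffAt ℝ ∞ (fun v : V => (∑ j, ‖v j‖ ^ 2)⁻¹ • star (v k)) w :=
    fun k => (ContDiffAt.inv (ContDiffAt.sum fun j _ => hn j) h).smul (hs k)
  have hm : ∀ k : Fin 2, ContDiffAt ℝ ∞ (fun v : V =>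
      (ContinuousLinearMap.mul ℝ ℍ ((∑ j, ‖v j‖ ^ 2)⁻¹ • star (v k))).comp
        (ContinuousLinearMap.proj (R := ℝ) (φ := fun _ : Fin 2 => ℍ) k)) w := fun k =>
    ContDiffAt.clm_comp (E := V) (F := ℍ) (G := ℍ)
      ((contDiffAt_const (c := ContinuousLinearMap.mul ℝ ℍ)).clm_apply (hc k)) contDiffAt_const
  exact ContDiffAt.sum (F := V →L[ℝ] ℍ) fun k _ => hm k

lemma hmul_left_mem_iff {l : Submodule ℍᵐᵒᵖ V} {v : V} {a : ℍ} (hv : v ∉ l)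
    (h : v <• a ∈ l) : a = 0 := by
  by_contra ha
  apply hv
  have := l.smul_mem (MulOpposite.op a⁻¹) h
  rwa [smul_hmul, mul_inv_cancel₀ ha, hmul_one] at this

/-- A vector `w ≠ 0` and a vector outside `wℍ` form a quaternionic basis of `ℍ²`. -/
lemma exists_eq_hmul_add {w v : V} (hw : w ≠ 0) (hv : v ∉ hline w) (x : V) :
    ∃ a b : ℍ, x = w <• a + v <• b := by
  -- `(a, b) ↦ w a + v b` is injective, and both sides have real dimension 8.
  let T : (ℍ × ℍ) →ₗ[ℝ] V :=
    ((col w).toLinearMap.comp (LinearMap.fst ℝ ℍ ℍ)) +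
      ((col v).toLinearMap.comp (LinearMap.snd ℝ ℍ ℍ))
  have hT : ∀ y, T y = w <• y.1 + v <• y.2 := fun y => rfl
  have hinj : Function.Injective T := by
    rw [injective_iff_map_eq_zero]
    rintro ⟨a, b⟩ h
    rw [hT] at h
    have hb : b = 0 := by
      refine hmul_left_mem_iff (a := b) hv ?_
      rw [← neg_eq_of_add_eq_zero_right h]
      exact Submodule.neg_mem _ (hmul_mem_hline _ _)
    simp only [hb, hmul_zero, add_zero] at h
    rw [hmul_eq_zero hw h, hb]
    rfl
  have hfin : Module.finrank ℝ (ℍ × ℍ) = Module.finrank ℝ V := by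
    rw [Module.finrank_prod, Module.finrank_pi_fintype]
    simp [two_mul]
  obtain ⟨⟨a, b⟩, h⟩ :=
    (LinearMap.injective_iff_surjective_of_finrank_eq_finrank hfin).1 hinj x
  exact ⟨a, b, h.symm⟩

lemma IsQuaternionic.hmul {B : EndV} (hB : IsQuaternionic B) (v : V) (a : ℍ) :
    B (v <• a) = B v <• a := hB v a

/-- Quaternionic linear maps which agree on a quaternionic basis are equal. -/
lemma IsQuaternionic.ext_basis {B C : EndV} (hB : IsQuaternionic B) (hC : IsQuaternionic C)
    {w v : V} (hw : w ≠ 0) (hv : v ∉ hline w) (h1 : B w = C w) (h2 : B v = C v) : B = C := by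
  ext1 x
  obtain ⟨a, b, rfl⟩ := exists_eq_hmul_add hw hv x
  rw [map_add, map_add, hB.hmul, hB.hmul, hC.hmul, hC.hmul, h1, h2]

lemma IsQuaternionic.mem_of_basis {B : EndV} (hB : IsQuaternionic B) {l : Submodule ℍᵐᵒᵖ V}
    {w v : V} (hw : w ≠ 0) (hv : v ∉ hline w) (h1 : B w ∈ l) (h2 : B v ∈ l) (x : V) :
    B x ∈ l := by
  obtain ⟨a, b, rfl⟩ := exists_eq_hmul_add hw hv x
  rw [map_add, hB.hmul, hB.hmul]
  exact l.add_mem (l.smul_mem _ h1) (l.smul_mem _ h2)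

lemma IsQuaternionic.map_hline {B : EndV} (hB : IsQuaternionic B) {l : Submodule ℍᵐᵒᵖ V}
    {w v : V} (h1 : B w ∈ l) (hv : v ∈ hline w) : B v ∈ l := by
  obtain ⟨a, rfl⟩ := mem_hline.1 hv
  rw [hB.hmul]
  exact l.smul_mem _ h1

lemma IsQuaternionic.eq_zero_of_mem_hline {B : EndV} (hB : IsQuaternionic B)
    {w v : V} (h1 : B w = 0) (hv : v ∈ hline w) : B v = 0 := by
  obtain ⟨a, rfl⟩ := mem_hline.1 hv
  rw [hB.hmul, h1, smul_zero]

lemma IsQuaternionic.add {B C : EndV} (hB : IsQuaternionic B) (hC : IsQuaternionic C) :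
    IsQuaternionic (B + C) := fun v a => by
  simp only [add_apply, hB v a, hC v a, map_add]

lemma IsQuaternionic.sub {B C : EndV} (hB : IsQuaternionic B) (hC : IsQuaternionic C) :
    IsQuaternionic (B - C) := fun v a => by
  simp only [sub_apply, hB v a, hC v a, map_sub]

lemma IsQuaternionic.real_smul {B : EndV} (hB : IsQuaternionic B) (r : ℝ) :
    IsQuaternionic (r • B) := fun v a => by
  simp only [smul_apply, hB v a, map_smul]

lemma IsQuaternionic.comp {B C : EndV} (hB : IsQuaternionic B) (hC : IsQuaternionic C) :
    IsQuaternionic (B.comp C) := fun v a => by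
  simp only [ContinuousLinearMap.comp_apply, hC v a, hB (C v) a]

/-! ### Derivatives of sections -/

section Calculus

variable {E F : Type*} [NormedAddCommGroup E] [NormedSpace ℝ E]
  [NormedAddCommGroup F] [NormedSpace ℝ F] {z : ℂ}

lemma fderiv_clm_apply_vec {B : ℂ → E →L[ℝ] F} {v : ℂ → E} (hB : DifferentiableAt ℝ B z)
    (hv : DifferentiableAt ℝ v z) (X : ℂ) :
    fderiv ℝ (fun w => B w (v w)) z X = fderiv ℝ B z X (v z) + B z (fderiv ℝ v z X) := by
  rw [fderiv_clm_apply hB hv]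
  simp [add_comm]

lemma fderiv_clm_apply_const {B : ℂ → E →L[ℝ] F} (hB : DifferentiableAt ℝ B z) (v : E) (X : ℂ) :
    fderiv ℝ (fun w => B w v) z X = fderiv ℝ B z X v := by
  rw [fderiv_clm_apply_vec hB (differentiableAt_const v)]
  simp

lemma fderiv_clm_comp (A : E →L[ℝ] F) {v : ℂ → E} (hv : DifferentiableAt ℝ v z) (X : ℂ) :
    fderiv ℝ (fun w => A (v w)) z X = A (fderiv ℝ v z X) := by
  rw [fderiv_clm_apply_vec (differentiableAt_const A) hv]
  simp

lemma differentiableAt_clm_comp (A : E →L[ℝ] F) {v : ℂ → E} (hv : DifferentiableAt ℝ v z) :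
    DifferentiableAt ℝ (fun w => A (v w)) z := by fun_prop

lemma fderiv_hmul {v : ℂ → V} {t : ℂ → ℍ} (hv : DifferentiableAt ℝ v z)
    (ht : DifferentiableAt ℝ t z) (X : ℂ) :
    fderiv ℝ (fun w => v w <• t w) z X = fderiv ℝ v z X <• t z + v z <• fderiv ℝ t z X := by
  have h : DifferentiableAt ℝ (fun w => col (v w)) z :=
    differentiableAt_clm_comp (E := V) (F := ℍ →L[ℝ] V) col hv
  have := fderiv_clm_apply_vec h ht X
  rw [fderiv_clm_comp (E := V) (F := ℍ →L[ℝ] V) col hv] at this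
  exact this

lemma contDiffAt_hmul {v : ℂ → V} {t : ℂ → ℍ} (hv : ContDiffAt ℝ ∞ v z)
    (ht : ContDiffAt ℝ ∞ t z) : ContDiffAt ℝ ∞ (fun w => v w <• t w) z := by
  have h : ContDiffAt ℝ ∞ (fun w => col (v w) (t w)) z := by fun_prop
  exact h

lemma contDiffAt_fderiv_apply {v : ℂ → E} (hv : ContDiffAt ℝ ∞ v z) (X : ℂ) :
    ContDiffAt ℝ ∞ (fun w => fderiv ℝ v w X) z :=
  (hv.fderiv_right (m := ∞) (by simp)).clm_apply contDiffAt_const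

lemma fderiv_fderiv_comm {v : ℂ → E} (hv : ContDiffAt ℝ ∞ v z) (X Y : ℂ) :
    fderiv ℝ (fun w => fderiv ℝ v w X) z Y = fderiv ℝ (fun w => fderiv ℝ v w Y) z X := by
  have h : DifferentiableAt ℝ (fderiv ℝ v) z :=
    (hv.fderiv_right (m := ∞) (by simp)).differentiableAt (by simp)
  rw [fderiv_clm_apply_const h, fderiv_clm_apply_const h]
  exact (hv.isSymmSndFDerivAt (by simp only [minSmoothness_of_isRCLikeNormedField]; exact ENat.LEInfty.out)).eq Y X

lemma isQuaternionic_fderiv {B : ℂ → EndV} (hB : DifferentiableAt ℝ B z)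
    (h : ∀ᶠ w in 𝓝 z, IsQuaternionic (B w)) (X : ℂ) : IsQuaternionic (fderiv ℝ B z X) := by
  intro v a
  rw [← fderiv_clm_apply_const hB, ← fderiv_clm_apply_const hB]
  have h1 : (fun w => B w (rightMul a v)) =ᶠ[𝓝 z] fun w => rightMul a (B w v) :=
    h.mono fun w hw => hw v a
  have h2 : DifferentiableAt ℝ (fun w => B w v) z := hB.clm_apply (differentiableAt_const v)
  rw [h1.fderiv_eq, fderiv_clm_comp (E := V) (F := V) (rightMul a) h2]

/-- If `v = φ t` is a section of the line bundle spanned by `φ`, then `∇v = ∇φ t` modulo this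
line bundle. -/
lemma fderiv_section_sub_mem {φ v : ℂ → V} (hφ : DifferentiableAt ℝ φ z)
    (hv : DifferentiableAt ℝ v z) (h0 : φ z ≠ 0) (h : ∀ᶠ w in 𝓝 z, v w ∈ hline (φ w)) {t : ℍ}
    (ht : v z = φ z <• t) (X : ℂ) :
    fderiv ℝ v z X - fderiv ℝ φ z X <• t ∈ hline (φ z) := by
  have hc : DifferentiableAt ℝ (fun w => hcoord (φ w) (v w)) z :=
    (((contDiffAt_hcoord h0).differentiableAt (by simp)).comp z hφ).clm_apply hv
  have h1 : v =ᶠ[𝓝 z] fun w => φ w <• hcoord (φ w) (v w) := by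
    filter_upwards [h, hφ.continuousAt.eventually_ne h0] with w hw hw0
    rw [hmul_hcoord hw0 hw]
  rw [h1.fderiv_eq, fderiv_hmul hφ hc, ht, hcoord_hmul h0, add_sub_cancel_left]
  exact hmul_mem_hline _ _

end Calculus


/-! ### Mean curvature spheres in a coordinate -/

/-- The coordinate form, at `z`, of the conditions on the mean curvature sphere congruence `S` of
the immersion whose line bundle is spanned by `φ`. Writing `z = x + iy`, the one-form equations
are evaluated at `∂ₓ`, where `⋆` becomes evaluation at `∂_y`. -/
structure SphereAt (φ : ℂ → V) (S : ℂ → EndV) (z : ℂ) : Prop where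
  smooth_frame : ContDiffAt ℝ ∞ φ z
  smooth : ContDiffAt ℝ ∞ S z
  ne_zero : φ z ≠ 0
  quaternionic : IsQuaternionic (S z)
  sq : ∀ v, S z (S z v) = -v
  maps : S z (φ z) ∈ hline (φ z)
  left : fderiv ℝ φ z Complex.I - S z (fderiv ℝ φ z 1) ∈ hline (φ z)
  right : fderiv ℝ φ z Complex.I - fderiv ℝ (fun w => S w (φ w)) z 1 ∈ hline (φ z)
  hopfQ : S z (fderiv ℝ S z 1 (φ z)) = fderiv ℝ S z Complex.I (φ z)
  immersed : fderiv ℝ φ z 1 ∉ hline (φ z)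

namespace SphereAt

variable {φ : ℂ → V} {S : ℂ → EndV} {z : ℂ}

lemma diff_frame (h : SphereAt φ S z) : DifferentiableAt ℝ φ z :=
  h.smooth_frame.differentiableAt (by simp)

lemma diff (h : SphereAt φ S z) : DifferentiableAt ℝ S z :=
  h.smooth.differentiableAt (by simp)

lemma map_mem (h : SphereAt φ S z) {v : V} (hv : v ∈ hline (φ z)) : S z v ∈ hline (φ z) :=
  h.quaternionic.map_hline h.maps hv

lemma fderiv_apply_frame (h : SphereAt φ S z) (X : ℂ) :
    fderiv ℝ (fun w => S w (φ w)) z X = fderiv ℝ S z X (φ z) + S z (fderiv ℝ φ z X) :=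
  fderiv_clm_apply_vec h.diff h.diff_frame X

lemma fderiv_one_frame_mem (h : SphereAt φ S z) : fderiv ℝ S z 1 (φ z) ∈ hline (φ z) := by
  have h1 := Submodule.sub_mem _ h.left h.right
  rw [h.fderiv_apply_frame] at h1
  convert h1 using 1
  abel

lemma fderiv_I_frame_mem (h : SphereAt φ S z) :
    fderiv ℝ S z Complex.I (φ z) ∈ hline (φ z) := by
  rw [← h.hopfQ]
  exact h.map_mem h.fderiv_one_frame_mem

variable (h : ∀ᶠ w in 𝓝 z, SphereAt φ S w)
include h

lemma quaternionic_fderiv (X : ℂ) : IsQuaternionic (fderiv ℝ S z X) :=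
  isQuaternionic_fderiv h.self_of_nhds.diff (h.mono fun _ hw => hw.quaternionic) X

/-- The derivative of a complex structure anticommutes with it. -/
lemma anticomm (X : ℂ) (v : V) : S z (fderiv ℝ S z X v) = -fderiv ℝ S z X (S z v) := by
  have hz := h.self_of_nhds
  have h1 : (fun w => S w (S w v)) =ᶠ[𝓝 z] fun _ => -v := h.mono fun w hw => hw.sq v
  have h2 := fderiv_clm_apply_vec hz.diff (hz.diff.clm_apply (differentiableAt_const v)) X
  rw [h1.fderiv_eq, fderiv_clm_apply_const hz.diff] at h2
  rw [eq_neg_iff_add_eq_zero, add_comm, ← h2]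
  simp

/-- The Hopf field `A` of the mean curvature sphere congruence takes values in the line bundle.
This is the condition dual to `Q|_L = 0`. -/
lemma hopfA_mem (v : V) :
    fderiv ℝ S z Complex.I v + S z (fderiv ℝ S z 1 v) ∈ hline (φ z) := by
  have hz := h.self_of_nhds
  have hq := quaternionic_fderiv h
  have hqA : IsQuaternionic (fderiv ℝ S z Complex.I + (S z).comp (fderiv ℝ S z 1)) :=
    (hq _).add (hz.quaternionic.comp (hq _))
  refine hqA.mem_of_basis (l := hline (φ z)) hz.ne_zero hz.immersed ?_ ?_ v
  · exact Submodule.add_mem _ hz.fderiv_I_frame_mem (hz.map_mem hz.fderiv_one_frame_mem)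
  · change fderiv ℝ S z Complex.I (fderiv ℝ φ z 1) + S z (fderiv ℝ S z 1 (fderiv ℝ φ z 1)) ∈ _
    obtain ⟨β, hβ⟩ := mem_hline.1 hz.maps
    obtain ⟨p, hp⟩ := mem_hline.1 hz.fderiv_one_frame_mem
    have hSx : ContDiffAt ℝ ∞ (fun w => fderiv ℝ S w 1) z := contDiffAt_fderiv_apply hz.smooth 1
    have hSy : ContDiffAt ℝ ∞ (fun w => fderiv ℝ S w Complex.I) z :=
      contDiffAt_fderiv_apply hz.smooth Complex.I
    have dSx := hSx.differentiableAt (by simp)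
    have dSy := hSy.differentiableAt (by simp)
    -- `S_x φ = φ p` and `S_y φ = φ β p` are sections of `L`. Modulo `L`, the `y`-derivative of the
    -- first and the `x`-derivative of the second are `φ_y p` and `φ_x β p`, which agree; comparing
    -- them removes the second derivative of `S`.
    have hyp : fderiv ℝ S z Complex.I (φ z) = φ z <• (β * p) := by
      rw [← hz.hopfQ, hp, hz.quaternionic.hmul, hβ, smul_hmul]
    have e1 := fderiv_section_sub_mem hz.diff_frame (dSx.clm_apply hz.diff_frame) hz.ne_zero
      (h.mono fun w hw => hw.fderiv_one_frame_mem) hp Complex.I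
    have e2 := fderiv_section_sub_mem hz.diff_frame (dSy.clm_apply hz.diff_frame) hz.ne_zero
      (h.mono fun w hw => hw.fderiv_I_frame_mem) hyp 1
    have e3 := fderiv_section_sub_mem hz.diff_frame (hz.diff.clm_apply hz.diff_frame) hz.ne_zero
      (h.mono fun w hw => hw.maps) hβ 1
    rw [fderiv_clm_apply_vec dSx hz.diff_frame] at e1
    rw [fderiv_clm_apply_vec dSy hz.diff_frame, fderiv_fderiv_comm hz.smooth] at e2
    have e4 : fderiv ℝ S z 1 (fderiv ℝ φ z Complex.I - S z (fderiv ℝ φ z 1)) ∈ hline (φ z) :=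
      (hq 1).map_hline hz.fderiv_one_frame_mem hz.left
    have e5 : (fderiv ℝ φ z Complex.I - fderiv ℝ φ z 1 <• β) <• p ∈ hline (φ z) := by
      refine Submodule.smul_mem _ _ ?_
      have := Submodule.add_mem _ hz.right e3
      rwa [sub_add_sub_cancel] at this
    have e6 := anticomm h 1 (fderiv ℝ φ z 1)
    rw [map_sub] at e4
    rw [smul_sub, smul_hmul] at e5
    have := Submodule.add_mem _ (Submodule.sub_mem _ (Submodule.add_mem _ e4 e2) e1)
      (Submodule.neg_mem _ e5)
    rw [e6]
    convert this using 1
    abel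

end SphereAt

/-- The mean curvature sphere congruence of an immersion is unique. -/
lemma SphereAt.unique {φ : ℂ → V} {S S' : ℂ → EndV} {z : ℂ} (h : ∀ᶠ w in 𝓝 z, SphereAt φ S w)
    (h' : ∀ᶠ w in 𝓝 z, SphereAt φ S' w) : S z = S' z := by
  -- On `L` both congruences are determined by `δ S = ⋆δ`.
  have key : ∀ w, (∀ᶠ u in 𝓝 w, SphereAt φ S u) → (∀ᶠ u in 𝓝 w, SphereAt φ S' u) →
      S w (φ w) = S' w (φ w) := by
    intro w hw hw'
    have a := hw.self_of_nhds
    have a' := hw'.self_of_nhds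
    obtain ⟨β, hβ⟩ := mem_hline.1 a.maps
    obtain ⟨β', hβ'⟩ := mem_hline.1 a'.maps
    have e := fderiv_section_sub_mem a.diff_frame (a.diff.clm_apply a.diff_frame) a.ne_zero
      (hw.mono fun w hw => hw.maps) hβ 1
    have e' := fderiv_section_sub_mem a.diff_frame (a'.diff.clm_apply a.diff_frame) a.ne_zero
      (hw'.mono fun w hw => hw.maps) hβ' 1
    have := Submodule.sub_mem _ (Submodule.add_mem _ a.right e) (Submodule.add_mem _ a'.right e')
    rw [sub_add_sub_cancel, sub_add_sub_cancel, sub_sub_sub_cancel_left, ← hmul_sub] at this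
    rw [hβ, hβ', ← sub_eq_zero.1 (hmul_left_mem_iff a.immersed this)]
  have hφ : (fun w => S w (φ w)) =ᶠ[𝓝 z] fun w => S' w (φ w) := by
    filter_upwards [h.eventually_nhds, h'.eventually_nhds] with w hw hw' using key w hw hw'
  have a := h.self_of_nhds
  have a' := h'.self_of_nhds
  -- The difference `D` kills `L` and maps to `L`. The conditions `Q|_L = 0` give `S D = D S` on
  -- `φ_x`, while `S² = S'² = -1` gives `S D = -D S`.
  set D := S z - S' z with hD
  have hqD : IsQuaternionic D := a.quaternionic.sub a'.quaternionic
  have hD0 : D (φ z) = 0 := by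
    rw [hD, sub_apply, sub_eq_zero]
    exact hφ.self_of_nhds
  have hd : ∀ X, fderiv ℝ S z X (φ z) - fderiv ℝ S' z X (φ z) = -D (fderiv ℝ φ z X) := by
    intro X
    have := congrArg (fun T => T X) (hφ.fderiv_eq (𝕜 := ℝ))
    simp only [a.fderiv_apply_frame, a'.fderiv_apply_frame] at this
    rw [hD, sub_apply, sub_eq_iff_eq_add, neg_sub, ← sub_eq_zero]
    rw [← sub_eq_zero] at this
    rw [← this]
    abel
  have hL : ∀ v ∈ hline (φ z), S' z v = S z v := by
    intro v hv
    have := hqD.eq_zero_of_mem_hline hD0 hv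
    rw [hD, sub_apply, sub_eq_zero] at this
    exact this.symm
  have hDx : D (fderiv ℝ φ z 1) ∈ hline (φ z) := by
    have := Submodule.sub_mem _ a'.left a.left
    rwa [sub_sub_sub_cancel_left] at this
  have hDy : D (fderiv ℝ φ z Complex.I) = D (S z (fderiv ℝ φ z 1)) := by
    have := hqD.eq_zero_of_mem_hline hD0 a.left
    rwa [map_sub, sub_eq_zero] at this
  have e1 : S z (D (fderiv ℝ φ z 1)) = D (S z (fderiv ℝ φ z 1)) := by
    have := hd Complex.I
    rw [← a.hopfQ, ← a'.hopfQ, hL _ a'.fderiv_one_frame_mem, ← map_sub, hd 1, map_neg, hDy,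
      neg_inj] at this
    exact this
  have e2 : D (S z (fderiv ℝ φ z 1)) + S z (D (fderiv ℝ φ z 1)) = 0 := by
    have h1 := a'.sq (fderiv ℝ φ z 1)
    have h2 : ∀ v, S' z v = S z v - D v := fun v => by rw [hD, sub_apply]; abel
    have h3 : S' z (fderiv ℝ φ z 1) = S z (fderiv ℝ φ z 1) - D (fderiv ℝ φ z 1) := h2 _
    rw [h3, map_sub, hL _ hDx, h2, a.sq] at h1
    rw [← neg_eq_zero, ← sub_eq_zero.2 h1]
    abel
  have e3 : D (fderiv ℝ φ z 1) = 0 := by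
    rw [← e1, ← two_smul ℝ, smul_eq_zero] at e2
    have h2 : S z (D (fderiv ℝ φ z 1)) = 0 := by simpa using e2
    have := a.sq (D (fderiv ℝ φ z 1))
    rw [h2, map_zero] at this
    rw [← neg_eq_zero, ← this]
  refine a.quaternionic.ext_basis a'.quaternionic a.ne_zero a.immersed ?_ ?_
  · exact hφ.self_of_nhds
  · exact sub_eq_zero.1 e3

/-! ### Constrained Willmore surfaces in a coordinate -/

/-- One-forms on the plane with values in `E`. -/
abbrev PlaneForm (E : Type*) [NormedAddCommGroup E] [NormedSpace ℝ E] : Type _ := ℂ → ℂ →L[ℝ] E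

/-- The coordinate form, at `z`, of the Euler-Lagrange equation, expressed by the closed form
`ω = 2⋆A + η` with values in `Hom(V, L)`; that `η = ω - 2⋆A` vanishes on `L` means that `ω + ∇S`
does. -/
structure WillmoreFormAt (φ : ℂ → V) (S : ℂ → EndV) (Ω : PlaneForm EndV) (z : ℂ) : Prop where
  smooth : ContDiffAt ℝ ∞ Ω z
  quaternionic : ∀ X, IsQuaternionic (Ω z X)
  mem : ∀ X v, Ω z X v ∈ hline (φ z)
  frame : ∀ X, Ω z X (φ z) + fderiv ℝ S z X (φ z) = 0
  closed : fderiv ℝ Ω z 1 Complex.I = fderiv ℝ Ω z Complex.I 1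

namespace WillmoreFormAt

variable {φ : ℂ → V} {S : ℂ → EndV} {Ω : PlaneForm EndV} {z : ℂ}

lemma diff (k : WillmoreFormAt φ S Ω z) : DifferentiableAt ℝ Ω z :=
  k.smooth.differentiableAt (by simp)

lemma smooth_apply (k : WillmoreFormAt φ S Ω z) (X : ℂ) : ContDiffAt ℝ ∞ (fun w => Ω w X) z :=
  k.smooth.clm_apply contDiffAt_const

lemma diff_apply (k : WillmoreFormAt φ S Ω z) (X : ℂ) : DifferentiableAt ℝ (fun w => Ω w X) z :=
  (k.smooth_apply X).differentiableAt (by simp)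

lemma closed_apply (k : WillmoreFormAt φ S Ω z) (v : V) :
    fderiv ℝ (fun w => Ω w Complex.I v) z 1 = fderiv ℝ (fun w => Ω w 1 v) z Complex.I := by
  rw [fderiv_clm_apply_const (k.diff_apply _), fderiv_clm_apply_const (k.diff_apply _),
    fderiv_clm_apply_const k.diff, fderiv_clm_apply_const k.diff, k.closed]

/-- `⋆ω = Sω`: modulo `L`, the equation `dω = 0` reads `δ ∧ ω = 0`. -/
lemma apply_I (h : ∀ᶠ w in 𝓝 z, SphereAt φ S w) (k : ∀ᶠ w in 𝓝 z, WillmoreFormAt φ S Ω w)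
    (v : V) : Ω z Complex.I v = S z (Ω z 1 v) := by
  have hz := h.self_of_nhds
  have kz := k.self_of_nhds
  obtain ⟨r, hr⟩ := mem_hline.1 (kz.mem 1 v)
  obtain ⟨r', hr'⟩ := mem_hline.1 (kz.mem Complex.I v)
  obtain ⟨β, hβ⟩ := mem_hline.1 hz.maps
  have e1 := fderiv_section_sub_mem hz.diff_frame
    ((kz.diff_apply 1).clm_apply (differentiableAt_const v)) hz.ne_zero
    (k.mono fun w hw => hw.mem 1 v) hr Complex.I
  have e2 := fderiv_section_sub_mem hz.diff_frame
    ((kz.diff_apply Complex.I).clm_apply (differentiableAt_const v)) hz.ne_zero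
    (k.mono fun w hw => hw.mem Complex.I v) hr' 1
  have e3 := fderiv_section_sub_mem hz.diff_frame (hz.diff.clm_apply hz.diff_frame) hz.ne_zero
    (h.mono fun w hw => hw.maps) hβ 1
  have e4 : (fderiv ℝ φ z Complex.I - fderiv ℝ φ z 1 <• β) <• r ∈ hline (φ z) := by
    refine Submodule.smul_mem _ _ ?_
    have := Submodule.add_mem _ hz.right e3
    rwa [sub_add_sub_cancel] at this
  rw [kz.closed_apply] at e2
  rw [smul_sub, smul_hmul] at e4
  -- Here `ω_x v = φ r` and `ω_y v = φ r'`.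
  have e5 : fderiv ℝ φ z 1 <• (r' - β * r) ∈ hline (φ z) := by
    have := Submodule.add_mem _ (Submodule.sub_mem _ e1 e2) e4
    rw [hmul_sub]
    convert this using 1
    abel
  rw [hr, hr', hz.quaternionic.hmul, hβ, smul_hmul,
    sub_eq_zero.1 (hmul_left_mem_iff hz.immersed e5)]

/-- `(ω + ∇S) ∧ δ = 0`, which follows by differentiating `(ω + ∇S)|_L = 0`. -/
lemma wedge_frame (h : ∀ᶠ w in 𝓝 z, SphereAt φ S w) (k : ∀ᶠ w in 𝓝 z, WillmoreFormAt φ S Ω w) :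
    Ω z 1 (fderiv ℝ φ z Complex.I) + fderiv ℝ S z 1 (fderiv ℝ φ z Complex.I) =
      Ω z Complex.I (fderiv ℝ φ z 1) + fderiv ℝ S z Complex.I (fderiv ℝ φ z 1) := by
  have hz := h.self_of_nhds
  have kz := k.self_of_nhds
  have e : ∀ X Y, fderiv ℝ Ω z Y X (φ z) + Ω z X (fderiv ℝ φ z Y)
      + (fderiv ℝ (fun w => fderiv ℝ S w X) z Y (φ z) + fderiv ℝ S z X (fderiv ℝ φ z Y)) = 0 := by
    intro X Y
    have dS : DifferentiableAt ℝ (fun w => fderiv ℝ S w X) z :=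
      (contDiffAt_fderiv_apply hz.smooth X).differentiableAt (by simp)
    have h1 : (fun w => Ω w X (φ w) + fderiv ℝ S w X (φ w)) =ᶠ[𝓝 z] fun _ => 0 :=
      k.mono fun w hw => hw.frame X
    have h2 := h1.fderiv_eq (𝕜 := ℝ)
    rw [fderiv_fun_add ((kz.diff_apply X).clm_apply hz.diff_frame)
      (dS.clm_apply hz.diff_frame)] at h2
    have h3 := congrArg (fun T => T Y) h2
    simp only [add_apply, fderiv_clm_apply_vec (kz.diff_apply X) hz.diff_frame,
      fderiv_clm_apply_vec dS hz.diff_frame, fderiv_clm_apply_const kz.diff] at h3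
    simpa using h3
  have e1 := e 1 Complex.I
  have e2 := e Complex.I 1
  rw [fderiv_fderiv_comm hz.smooth, kz.closed] at e2
  rw [← e2, kz.closed.symm] at e1
  rw [← sub_eq_zero] at e1 ⊢
  rw [kz.closed] at e1
  rw [← e1]
  abel

/-- The Lagrange multiplier `η = ω - 2⋆A` commutes with `S`: the Hopf field `Q` does not contribute
to `(ω + ∇S) ∧ δ = 0`, so that `η ∧ δ = 0`. The vector `φ_x` spans `ℍ²` modulo `L`, on which `η`
vanishes. -/
lemma multiplier_comm (h : ∀ᶠ w in 𝓝 z, SphereAt φ S w)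
    (k : ∀ᶠ w in 𝓝 z, WillmoreFormAt φ S Ω w) :
    Ω z 1 (S z (fderiv ℝ φ z 1)) - (1 / 2 : ℝ) • (S z (fderiv ℝ S z Complex.I
        (S z (fderiv ℝ φ z 1))) - fderiv ℝ S z 1 (S z (fderiv ℝ φ z 1))) =
      S z (Ω z 1 (fderiv ℝ φ z 1) - (1 / 2 : ℝ) • (S z (fderiv ℝ S z Complex.I
        (fderiv ℝ φ z 1)) - fderiv ℝ S z 1 (fderiv ℝ φ z 1))) := by
  have hz := h.self_of_nhds
  have kz := k.self_of_nhds
  have hw := wedge_frame h k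
  have hl : Ω z 1 (fderiv ℝ φ z Complex.I - S z (fderiv ℝ φ z 1))
      + fderiv ℝ S z 1 (fderiv ℝ φ z Complex.I - S z (fderiv ℝ φ z 1)) = 0 := by
    have hq : IsQuaternionic (Ω z 1 + fderiv ℝ S z 1) :=
      (kz.quaternionic 1).add (SphereAt.quaternionic_fderiv h 1)
    exact hq.eq_zero_of_mem_hline (kz.frame 1) hz.left
  rw [map_sub, map_sub] at hl
  rw [apply_I h k] at hw
  generalize fderiv ℝ φ z 1 = u at *
  have e1 : Ω z 1 (S z u) = S z (Ω z 1 u) + fderiv ℝ S z Complex.I u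
      - fderiv ℝ S z 1 (S z u) := by
    rw [← hw, ← sub_eq_zero, ← neg_eq_zero, ← hl]
    abel
  have e2 : fderiv ℝ S z 1 (S z u) = -S z (fderiv ℝ S z 1 u) := by
    rw [SphereAt.anticomm h, neg_neg]
  have e3 : S z (fderiv ℝ S z Complex.I (S z u)) = fderiv ℝ S z Complex.I u := by
    rw [SphereAt.anticomm h, hz.sq, map_neg, neg_neg]
  rw [e1, e3, e2, map_sub, map_smul, map_sub, hz.sq]
  module

/-- If `ω` anticommutes with `S`, then the Lagrange multiplier vanishes, that is, `ω = 2⋆A`: it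
commutes with `S`, and `2⋆A` anticommutes with `S`. -/
lemma eq_hopf (h : ∀ᶠ w in 𝓝 z, SphereAt φ S w)
    (k : ∀ᶠ w in 𝓝 z, WillmoreFormAt φ S Ω w)
    (hΩ : Ω z 1 (S z (fderiv ℝ φ z 1)) = -S z (Ω z 1 (fderiv ℝ φ z 1))) :
    Ω z 1 = (1 / 2 : ℝ) • ((S z).comp (fderiv ℝ S z Complex.I) - fderiv ℝ S z 1) ∧
    Ω z Complex.I = (1 / 2 : ℝ) • (-(S z).comp (fderiv ℝ S z 1) - fderiv ℝ S z Complex.I) := by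
  have hz := h.self_of_nhds
  have kz := k.self_of_nhds
  have hc := multiplier_comm h k
  have hq := SphereAt.quaternionic_fderiv h
  have first : Ω z 1 = (1 / 2 : ℝ) • ((S z).comp (fderiv ℝ S z Complex.I) - fderiv ℝ S z 1) := by
    refine (kz.quaternionic 1).ext_basis
      (((hz.quaternionic.comp (hq _)).sub (hq _)).real_smul _) hz.ne_zero hz.immersed ?_ ?_
    · have := kz.frame 1
      rw [← eq_neg_iff_add_eq_zero] at this
      rw [this]
      simp only [smul_apply, sub_apply, ContinuousLinearMap.comp_apply]
      rw [← hz.hopfQ, hz.sq]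
      module
    · simp only [smul_apply, sub_apply, ContinuousLinearMap.comp_apply]
      generalize fderiv ℝ φ z 1 = u at *
      have e2 : fderiv ℝ S z 1 (S z u) = -S z (fderiv ℝ S z 1 u) := by
        rw [SphereAt.anticomm h, neg_neg]
      have e3 : S z (fderiv ℝ S z Complex.I (S z u)) = fderiv ℝ S z Complex.I u := by
        rw [SphereAt.anticomm h, hz.sq, map_neg, neg_neg]
      rw [hΩ, e2, e3, map_sub, map_smul, map_sub, hz.sq] at hc
      have e4 : S z (Ω z 1 u) = (1 / 2 : ℝ) •
          (-fderiv ℝ S z Complex.I u - S z (fderiv ℝ S z 1 u)) := by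
        have h5 : (2 : ℝ) • S z (Ω z 1 u) =
            (2 : ℝ) • ((1 / 2 : ℝ) • (-fderiv ℝ S z Complex.I u - S z (fderiv ℝ S z 1 u))) := by
          rw [← sub_eq_zero] at hc ⊢
          rw [← neg_eq_zero, ← hc]
          module
        exact smul_right_injective V (two_ne_zero (α := ℝ)) h5
      have e6 := congrArg (S z) e4
      rw [hz.sq, map_smul, map_sub, map_neg, hz.sq] at e6
      rw [← neg_inj, e6]
      module
  refine ⟨first, ?_⟩
  ext1 v
  rw [apply_I h k, first]
  simp only [smul_apply, sub_apply, ContinuousLinearMap.comp_apply, map_smul, map_sub, hz.sq,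
    neg_apply]
  module

end WillmoreFormAt


/-! ### The Darboux transform of the mean curvature sphere -/

lemma hline_eq_of_mem {v w : V} (hv : v ∈ hline w) (h0 : v ≠ 0) : hline v = hline w := by
  obtain ⟨a, rfl⟩ := mem_hline.1 hv
  have ha : a ≠ 0 := by
    rintro rfl
    exact h0 (hmul_zero _)
  apply le_antisymm
  · rw [Submodule.span_singleton_le_iff_mem]
    exact hv
  · rw [Submodule.span_singleton_le_iff_mem]
    refine mem_hline.2 ⟨a⁻¹, ?_⟩
    rw [smul_hmul, mul_inv_cancel₀ ha, hmul_one]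

/-- For `u, p` a quaternionic basis of `ℍ²`: the second coordinate functional, sending `u a + p b`
to `b`. It first removes the orthogonal projection to `uℍ`, which makes it a smooth function of
`u` and `p`. -/
def sndCoord (p u : V) : V →L[ℝ] ℍ :=
  (hcoord (p - u <• hcoord u p)).comp
    (ContinuousLinearMap.id ℝ V - (col u).comp (hcoord u))

/-- The functional `y` with `ω(X) = dψ(X) y`, where `u = dψ(X)` and `Ω = ω(X)`. -/
def quotForm (u : V) (Ω : EndV) : V →L[ℝ] ℍ := (hcoord u).comp Ω

/-- The endomorphism `Y = ψ y`, where `p = ψ`, and `ω = dψ y` is evaluated as in `quotForm`. -/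
def darbouxY (p u : V) (Ω : EndV) : EndV := (col p).comp (quotForm u Ω)

/-- The quaternion `β` with `S u = u β`. -/
def eigenQuat (u : V) (S : EndV) : ℍ := hcoord u (S u)

/-- The mean curvature sphere of the Darboux transform: it is `S + Y` on `L = uℍ`, and sends
`p = ψ` to `ψ β`, where `S u = u β`. -/
def darbouxSphere (p u : V) (S Ω : EndV) : EndV :=
  (S + darbouxY p u Ω).comp (ContinuousLinearMap.id ℝ V - (col p).comp (sndCoord p u)) +
    (col (p <• eigenQuat u S)).comp (sndCoord p u)

section Algebra

variable {p u : V} {S Ω : EndV}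

lemma sndCoord_right (v : V) (a : ℍ) : sndCoord p u (v <• a) = sndCoord p u v * a := by
  simp only [sndCoord, ContinuousLinearMap.comp_apply, sub_apply, ContinuousLinearMap.id_apply,
    col_apply, hcoord_right]
  rw [← smul_hmul, ← smul_sub, hcoord_right]

lemma sndCoord_of_mem (hu : u ≠ 0) {v : V} (hv : v ∈ hline u) : sndCoord p u v = 0 := by
  simp only [sndCoord, ContinuousLinearMap.comp_apply, sub_apply, ContinuousLinearMap.id_apply,
    col_apply, hmul_hcoord hu hv, sub_self, map_zero]

lemma sub_hmul_hcoord_ne_zero (hp : p ∉ hline u) : p - u <• hcoord u p ≠ 0 := by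
  intro h
  apply hp
  rw [sub_eq_zero.1 h]
  exact hmul_mem_hline _ _

lemma sndCoord_self (hp : p ∉ hline u) : sndCoord p u p = 1 := by
  simp only [sndCoord, ContinuousLinearMap.comp_apply, sub_apply, ContinuousLinearMap.id_apply,
    col_apply]
  have := hcoord_hmul (sub_hmul_hcoord_ne_zero hp) 1
  rwa [hmul_one] at this

lemma darbouxY_apply (v : V) : darbouxY p u Ω v = p <• quotForm u Ω v := rfl

lemma quotForm_right (hΩ : IsQuaternionic Ω) (v : V) (a : ℍ) :
    quotForm u Ω (v <• a) = quotForm u Ω v * a := by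
  simp only [quotForm, ContinuousLinearMap.comp_apply, hΩ.hmul, hcoord_right]

lemma isQuaternionic_darbouxY (hΩ : IsQuaternionic Ω) : IsQuaternionic (darbouxY p u Ω) := by
  intro v a
  simp only [rightMul_apply, darbouxY_apply, quotForm_right hΩ, smul_hmul]

lemma isQuaternionic_darbouxSphere (hS : IsQuaternionic S) (hΩ : IsQuaternionic Ω) :
    IsQuaternionic (darbouxSphere p u S Ω) := by
  have hc : ∀ q : V, IsQuaternionic ((col q).comp (sndCoord p u)) := by
    intro q v a
    simp only [ContinuousLinearMap.comp_apply, rightMul_apply, sndCoord_right, col_apply,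
      smul_hmul]
  exact ((hS.add (isQuaternionic_darbouxY hΩ)).comp
    (IsQuaternionic.sub (fun _ _ => rfl) (hc p))).add (hc _)

lemma darbouxSphere_of_mem (hu : u ≠ 0) {v : V} (hv : v ∈ hline u) :
    darbouxSphere p u S Ω v = S v + p <• quotForm u Ω v := by
  simp [darbouxSphere, sndCoord_of_mem hu hv, darbouxY_apply]

lemma darbouxSphere_self (hp : p ∉ hline u) :
    darbouxSphere p u S Ω p = p <• eigenQuat u S := by
  simp [darbouxSphere, sndCoord_self hp]

end Algebra

/-- The coordinate form of what is used of a `∇^μ`-parallel section `ψ`, at a point `z` at which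
the surface spanned by `ψ` is immersed. The condition `ωψ = S dψ - dψ c` is evaluated at `∂ₓ`. -/
structure TransformAt (φ : ℂ → V) (S : ℂ → EndV) (Ω : PlaneForm EndV) (ψ : ℂ → V) (c : ℍ) (z : ℂ) :
    Prop where
  smooth : ContDiffAt ℝ ∞ ψ z
  not_mem : ψ z ∉ hline (φ z)
  mem : fderiv ℝ ψ z 1 ∈ hline (φ z)
  apply_I : fderiv ℝ ψ z Complex.I = S z (fderiv ℝ ψ z 1)
  ne_zero : fderiv ℝ ψ z 1 ≠ 0
  form : Ω z 1 (ψ z) = S z (fderiv ℝ ψ z 1) - fderiv ℝ ψ z 1 <• c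

lemma clm_eq_re_im {E : Type*} [NormedAddCommGroup E] [NormedSpace ℝ E] (T : ℂ →L[ℝ] E) (X : ℂ) :
    T X = X.re • T 1 + X.im • T Complex.I := by
  rw [← map_smul, ← map_smul, ← map_add]
  congr 1
  apply Complex.ext <;> simp

section Calculus

variable {E F : Type*} [NormedAddCommGroup E] [NormedSpace ℝ E]
  [NormedAddCommGroup F] [NormedSpace ℝ F] {z : ℂ}

lemma contDiffAt_clm_comp (A : E →L[ℝ] F) {v : ℂ → E} (hv : ContDiffAt ℝ ∞ v z) :
    ContDiffAt ℝ ∞ (fun w => A (v w)) z := A.contDiff.contDiffAt.comp z hv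

lemma contDiffAt_fun_comp {G : E → F} {v : ℂ → E} (hG : ContDiffAt ℝ ∞ G (v z))
    (hv : ContDiffAt ℝ ∞ v z) : ContDiffAt ℝ ∞ (fun w => G (v w)) z := hG.comp z hv

lemma contDiffAt_sub_fderiv {Ω : PlaneForm E} {P : ℂ → E} (hΩ : ContDiffAt ℝ ∞ Ω z)
    (hP : ContDiffAt ℝ ∞ P z) : ContDiffAt ℝ ∞ (fun w => Ω w - fderiv ℝ P w) z :=
  hΩ.sub (hP.fderiv_right (m := ∞) (by simp))

/-- Subtracting an exact form from a closed form leaves it closed. -/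
lemma closed_sub_fderiv {Ω : PlaneForm E} {P : ℂ → E} (hΩ : ContDiffAt ℝ ∞ Ω z)
    (hP : ContDiffAt ℝ ∞ P z) (h : fderiv ℝ Ω z 1 Complex.I = fderiv ℝ Ω z Complex.I 1) :
    fderiv ℝ (fun w => Ω w - fderiv ℝ P w) z 1 Complex.I =
      fderiv ℝ (fun w => Ω w - fderiv ℝ P w) z Complex.I 1 := by
  have hdP : ContDiffAt ℝ ∞ (fderiv ℝ P) z := hP.fderiv_right (m := ∞) (by simp)
  have hs := hP.isSymmSndFDerivAt
    (by simp only [minSmoothness_of_isRCLikeNormedField]; exact ENat.LEInfty.out)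
  rw [fderiv_fun_sub (hΩ.differentiableAt (by simp)) (hdP.differentiableAt (by simp))]
  simp only [sub_apply, h]
  rw [hs.eq]

end Calculus

namespace TransformAt

variable {φ : ℂ → V} {S : ℂ → EndV} {Ω : PlaneForm EndV} {ψ : ℂ → V} {c : ℍ} {z : ℂ}

/-- The functional `y` with `ω = dψ y`, as a function of the coordinate. -/
def y (Ω : PlaneForm EndV) (ψ : ℂ → V) (w : ℂ) : V →L[ℝ] ℍ := quotForm (fderiv ℝ ψ w 1) (Ω w 1)

/-- The quaternion `β` with `S dψ = dψ β`, as a function of the coordinate. -/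
def b (S : ℂ → EndV) (ψ : ℂ → V) (w : ℂ) : ℍ := eigenQuat (fderiv ℝ ψ w 1) (S w)

/-- The mean curvature sphere of the Darboux transform, as a function of the coordinate. -/
def sphere (S : ℂ → EndV) (Ω : PlaneForm EndV) (ψ : ℂ → V) (w : ℂ) : EndV :=
  darbouxSphere (ψ w) (fderiv ℝ ψ w 1) (S w) (Ω w 1)

/-- The endomorphism `Y = ψ y`, as a function of the coordinate. -/
def pot (Ω : PlaneForm EndV) (ψ : ℂ → V) (w : ℂ) : EndV :=
  darbouxY (ψ w) (fderiv ℝ ψ w 1) (Ω w 1)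

/-- The closed form `ω - dY` of the Darboux transform. -/
def sharpForm (Ω : PlaneForm EndV) (ψ : ℂ → V) : PlaneForm EndV :=
  fun w => Ω w - fderiv ℝ (pot Ω ψ) w

section Pointwise

variable (t : TransformAt φ S Ω ψ c z)
include t

lemma hline_eq : hline (fderiv ℝ ψ z 1) = hline (φ z) := hline_eq_of_mem t.mem t.ne_zero

lemma not_mem' : ψ z ∉ hline (fderiv ℝ ψ z 1) := by
  rw [t.hline_eq]
  exact t.not_mem

lemma psi_ne_zero : ψ z ≠ 0 := by
  intro h
  apply t.not_mem
  rw [h]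
  exact Submodule.zero_mem _

lemma diff : DifferentiableAt ℝ ψ z := t.smooth.differentiableAt (by simp)

lemma apply_one (h : SphereAt φ S z) :
    S z (fderiv ℝ ψ z 1) = fderiv ℝ ψ z 1 <• b S ψ z := by
  refine (hmul_hcoord t.ne_zero ?_).symm
  rw [t.hline_eq]
  exact h.map_mem t.mem

lemma form_one (k : WillmoreFormAt φ S Ω z) (v : V) :
    Ω z 1 v = fderiv ℝ ψ z 1 <• y Ω ψ z v := by
  refine (hmul_hcoord t.ne_zero ?_).symm
  rw [t.hline_eq]
  exact k.mem 1 v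

lemma apply_fderiv (h : SphereAt φ S z) (X : ℂ) :
    S z (fderiv ℝ ψ z X) = fderiv ℝ ψ z X <• b S ψ z := by
  rw [clm_eq_re_im (fderiv ℝ ψ z) X, map_add, map_smul, map_smul, t.apply_I, t.apply_one h,
    h.quaternionic.hmul, t.apply_one h, smul_add, smul_comm, smul_comm _ X.im]

lemma fderiv_mem (h : SphereAt φ S z) (X : ℂ) : fderiv ℝ ψ z X ∈ hline (φ z) := by
  rw [clm_eq_re_im (fderiv ℝ ψ z) X, t.apply_I]
  exact Submodule.add_mem _ (Submodule.smul_of_tower_mem _ _ t.mem)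
    (Submodule.smul_of_tower_mem _ _ (h.map_mem t.mem))

lemma b_mul_self (h : SphereAt φ S z) : b S ψ z * b S ψ z = -1 := by
  apply hmul_left_cancel t.ne_zero
  rw [← smul_hmul, ← t.apply_one h, ← h.quaternionic.hmul, ← t.apply_one h, h.sq, hmul_neg,
    hmul_one]

lemma b_eq (h : SphereAt φ S z) (k : WillmoreFormAt φ S Ω z) :
    b S ψ z = y Ω ψ z (ψ z) + c := by
  apply hmul_left_cancel t.ne_zero
  rw [hmul_add, ← t.form_one k, t.form, t.apply_one h, sub_add_cancel]

lemma sphere_self : sphere S Ω ψ z (ψ z) = ψ z <• b S ψ z := darbouxSphere_self t.not_mem'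

lemma sphere_of_mem {v : V} (hv : v ∈ hline (φ z)) :
    sphere S Ω ψ z v = S z v + ψ z <• y Ω ψ z v := by
  rw [← t.hline_eq] at hv
  exact darbouxSphere_of_mem t.ne_zero hv

lemma smooth_u : ContDiffAt ℝ ∞ (fun w => fderiv ℝ ψ w 1) z := contDiffAt_fderiv_apply t.smooth 1

lemma smooth_hcoord : ContDiffAt ℝ ∞ (fun w => hcoord (fderiv ℝ ψ w 1)) z :=
  contDiffAt_fun_comp (E := V) (F := V →L[ℝ] ℍ) (contDiffAt_hcoord t.ne_zero) t.smooth_u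

lemma smooth_y (k : WillmoreFormAt φ S Ω z) : ContDiffAt ℝ ∞ (y Ω ψ) z :=
  ContDiffAt.clm_comp (E := V) (F := V) (G := ℍ) t.smooth_hcoord (k.smooth_apply 1)

lemma smooth_b (h : SphereAt φ S z) : ContDiffAt ℝ ∞ (b S ψ) z :=
  t.smooth_hcoord.clm_apply (h.smooth.clm_apply t.smooth_u)

lemma smooth_pot (k : WillmoreFormAt φ S Ω z) : ContDiffAt ℝ ∞ (pot Ω ψ) z := by
  have : ContDiffAt ℝ ∞ (fun w => col (ψ w)) z :=
    contDiffAt_clm_comp (E := V) (F := ℍ →L[ℝ] V) col t.smooth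
  exact ContDiffAt.clm_comp (E := V) (F := ℍ) (G := V) this (t.smooth_y k)

lemma smooth_sndCoord : ContDiffAt ℝ ∞ (fun w => sndCoord (ψ w) (fderiv ℝ ψ w 1)) z := by
  have hN : ContDiffAt ℝ ∞
      (fun w => ψ w - fderiv ℝ ψ w 1 <• hcoord (fderiv ℝ ψ w 1) (ψ w)) z :=
    t.smooth.sub (contDiffAt_hmul t.smooth_u (t.smooth_hcoord.clm_apply t.smooth))
  have hc : ContDiffAt ℝ ∞
      (fun w => hcoord (ψ w - fderiv ℝ ψ w 1 <• hcoord (fderiv ℝ ψ w 1) (ψ w))) z :=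
    contDiffAt_fun_comp (E := V) (F := V →L[ℝ] ℍ)
      (contDiffAt_hcoord (sub_hmul_hcoord_ne_zero t.not_mem')) hN
  have hu : ContDiffAt ℝ ∞ (fun w => col (fderiv ℝ ψ w 1)) z :=
    contDiffAt_clm_comp (E := V) (F := ℍ →L[ℝ] V) col t.smooth_u
  have hp : ContDiffAt ℝ ∞
      (fun w => (col (fderiv ℝ ψ w 1)).comp (hcoord (fderiv ℝ ψ w 1))) z :=
    ContDiffAt.clm_comp (E := V) (F := ℍ) (G := V) hu t.smooth_hcoord
  exact ContDiffAt.clm_comp (E := V) (F := V) (G := ℍ) hc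
    (ContDiffAt.sub (F := V →L[ℝ] V) contDiffAt_const hp)

lemma smooth_sphere (h : SphereAt φ S z) (k : WillmoreFormAt φ S Ω z) :
    ContDiffAt ℝ ∞ (sphere S Ω ψ) z := by
  have h1 : ContDiffAt ℝ ∞ (fun w => col (ψ w)) z :=
    contDiffAt_clm_comp (E := V) (F := ℍ →L[ℝ] V) col t.smooth
  have h2 : ContDiffAt ℝ ∞ (fun w => col (ψ w <• b S ψ w)) z :=
    contDiffAt_clm_comp (E := V) (F := ℍ →L[ℝ] V) col (contDiffAt_hmul t.smooth (t.smooth_b h))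
  have h3 := ContDiffAt.clm_comp (E := V) (F := ℍ) (G := V) h1 t.smooth_sndCoord
  have h4 := ContDiffAt.clm_comp (E := V) (F := ℍ) (G := V) h2 t.smooth_sndCoord
  have h5 := ContDiffAt.clm_comp (E := V) (F := V) (G := V)
    (ContDiffAt.add (F := V →L[ℝ] V) h.smooth (t.smooth_pot k))
    (ContDiffAt.sub (F := V →L[ℝ] V) (contDiffAt_const (c := ContinuousLinearMap.id ℝ V)) h3)
  exact ContDiffAt.add (F := V →L[ℝ] V) h5 h4

lemma form_apply (h : ∀ᶠ w in 𝓝 z, SphereAt φ S w) (k : ∀ᶠ w in 𝓝 z, WillmoreFormAt φ S Ω w)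
    (X : ℂ) (v : V) : Ω z X v = fderiv ℝ ψ z X <• y Ω ψ z v := by
  have hz := h.self_of_nhds
  rw [clm_eq_re_im (Ω z) X, clm_eq_re_im (fderiv ℝ ψ z) X, add_apply, smul_apply, smul_apply,
    WillmoreFormAt.apply_I h k, t.form_one k.self_of_nhds, t.apply_I, hz.quaternionic.hmul,
    smul_add, smul_comm, smul_comm _ X.im]

end Pointwise

section Local

lemma diff_y (k : ∀ᶠ w in 𝓝 z, WillmoreFormAt φ S Ω w)
    (t : ∀ᶠ w in 𝓝 z, TransformAt φ S Ω ψ c w) : DifferentiableAt ℝ (y Ω ψ) z :=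
  (t.self_of_nhds.smooth_y k.self_of_nhds).differentiableAt (by simp)

variable (h : ∀ᶠ w in 𝓝 z, SphereAt φ S w) (k : ∀ᶠ w in 𝓝 z, WillmoreFormAt φ S Ω w)
  (t : ∀ᶠ w in 𝓝 z, TransformAt φ S Ω ψ c w)
include h k t

/-- `⋆dy = β dy`, since `dω = 0` reads `dψ ∧ dy = 0`. -/
lemma fderiv_y_I (v : V) :
    fderiv ℝ (y Ω ψ) z Complex.I v = b S ψ z * fderiv ℝ (y Ω ψ) z 1 v := by
  have tz := t.self_of_nhds
  have hy := diff_y k t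
  have hyv : DifferentiableAt ℝ (fun w => y Ω ψ w v) z := hy.clm_apply (differentiableAt_const v)
  have e := k.self_of_nhds.closed_apply v
  have e1 : ∀ X, (fun w => Ω w X v) =ᶠ[𝓝 z] fun w => fderiv ℝ ψ w X <• y Ω ψ w v := by
    intro X
    filter_upwards [h.eventually_nhds, k.eventually_nhds, t] with w hw kw tw
      using tw.form_apply hw kw X v
  have du : ∀ X, DifferentiableAt ℝ (fun w => fderiv ℝ ψ w X) z := fun X =>
    (contDiffAt_fderiv_apply tz.smooth X).differentiableAt (by simp)
  rw [(e1 _).fderiv_eq, (e1 _).fderiv_eq, fderiv_hmul (du _) hyv, fderiv_hmul (du _) hyv,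
    fderiv_fderiv_comm tz.smooth, add_right_inj, fderiv_clm_apply_const hy,
    fderiv_clm_apply_const hy, tz.apply_I, tz.apply_one h.self_of_nhds, smul_hmul] at e
  exact (hmul_left_cancel tz.ne_zero e).symm

/-- `(∇S♯) ψ = ψ (dy ψ)`, by differentiating `S♯ ψ = ψ β` and `β = y(ψ) + c`. -/
lemma fderiv_sphere_self (X : ℂ) :
    fderiv ℝ (sphere S Ω ψ) z X (ψ z) = ψ z <• fderiv ℝ (y Ω ψ) z X (ψ z) := by
  have hz := h.self_of_nhds
  have kz := k.self_of_nhds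
  have tz := t.self_of_nhds
  have hy := diff_y k t
  have hb : DifferentiableAt ℝ (b S ψ) z := (tz.smooth_b hz).differentiableAt (by simp)
  have hT : DifferentiableAt ℝ (sphere S Ω ψ) z :=
    (tz.smooth_sphere hz kz).differentiableAt (by simp)
  have e1 : (fun w => sphere S Ω ψ w (ψ w)) =ᶠ[𝓝 z] fun w => ψ w <• b S ψ w :=
    t.mono fun w tw => tw.sphere_self
  have e2 : b S ψ =ᶠ[𝓝 z] fun w => y Ω ψ w (ψ w) + c := by
    filter_upwards [h, k, t] with w hw kw tw using tw.b_eq hw kw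
  have e3 := congrArg (fun T => T X) (e1.fderiv_eq (𝕜 := ℝ))
  rw [fderiv_clm_apply_vec hT tz.diff, fderiv_hmul tz.diff hb, e2.fderiv_eq, fderiv_add_const,
    fderiv_clm_apply_vec hy tz.diff, tz.sphere_of_mem (tz.fderiv_mem hz X),
    tz.apply_fderiv hz, hmul_add] at e3
  rw [← sub_eq_zero] at e3 ⊢
  rw [← e3]
  abel

/-- `ω - dY = -ψ dy`. -/
lemma sharpForm_apply (X : ℂ) (v : V) :
    sharpForm Ω ψ z X v = -(ψ z <• fderiv ℝ (y Ω ψ) z X v) := by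
  have tz := t.self_of_nhds
  have hy := diff_y k t
  have hP : DifferentiableAt ℝ (pot Ω ψ) z :=
    (tz.smooth_pot k.self_of_nhds).differentiableAt (by simp)
  change (Ω z X - fderiv ℝ (pot Ω ψ) z X) v = _
  rw [sub_apply, ← fderiv_clm_apply_const hP, tz.form_apply h k]
  change _ - fderiv ℝ (fun w => ψ w <• y Ω ψ w v) z X = _
  rw [fderiv_hmul tz.diff (hy.clm_apply (differentiableAt_const v)), fderiv_clm_apply_const hy]
  abel

/-- `y S = -β y` on the line bundle, since `ω = -∇S` there. -/
lemma y_sphere {v : V} (hv : v ∈ hline (φ z)) :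
    y Ω ψ z (S z v) = -(b S ψ z * y Ω ψ z v) := by
  have hz := h.self_of_nhds
  have kz := k.self_of_nhds
  have tz := t.self_of_nhds
  have hq : IsQuaternionic (Ω z 1 + fderiv ℝ S z 1) :=
    (kz.quaternionic 1).add (SphereAt.quaternionic_fderiv h 1)
  have hΩ : ∀ x ∈ hline (φ z), Ω z 1 x = -fderiv ℝ S z 1 x := fun x hx =>
    eq_neg_of_add_eq_zero_left (hq.eq_zero_of_mem_hline (kz.frame 1) hx)
  apply hmul_left_cancel tz.ne_zero
  rw [← tz.form_one kz, hΩ _ (hz.map_mem hv), ← SphereAt.anticomm h, hmul_neg, ← smul_hmul,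
    ← tz.apply_one hz, ← hz.quaternionic.hmul, ← tz.form_one kz, hΩ _ hv, map_neg, neg_neg]

/-- The endomorphism field `S♯` is the mean curvature sphere congruence of the Darboux
transform. The condition `Q♯ ψ = 0` is `⋆dy = β dy`, evaluated on `ψ`. -/
lemma sphereAt : SphereAt ψ (sphere S Ω ψ) z := by
  have hz := h.self_of_nhds
  have kz := k.self_of_nhds
  have tz := t.self_of_nhds
  have hq : IsQuaternionic (sphere S Ω ψ z) :=
    isQuaternionic_darbouxSphere hz.quaternionic (kz.quaternionic 1)
  have hT : DifferentiableAt ℝ (sphere S Ω ψ) z :=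
    (tz.smooth_sphere hz kz).differentiableAt (by simp)
  have hTu := tz.sphere_of_mem tz.mem
  refine ⟨tz.smooth, tz.smooth_sphere hz kz, tz.psi_ne_zero, hq, ?_, ?_, ?_, ?_, ?_, ?_⟩
  · have hsq : (sphere S Ω ψ z).comp (sphere S Ω ψ z) = -ContinuousLinearMap.id ℝ V := by
      refine (hq.comp hq).ext_basis (fun v a => by simp) tz.ne_zero tz.not_mem' ?_ ?_
      · rw [ContinuousLinearMap.comp_apply, hTu, map_add, hq.hmul, tz.sphere_self,
          tz.sphere_of_mem (hz.map_mem tz.mem), y_sphere h k t tz.mem, hz.sq, smul_hmul, hmul_neg]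
        simp
      · rw [ContinuousLinearMap.comp_apply, tz.sphere_self, hq.hmul, tz.sphere_self, smul_hmul,
          tz.b_mul_self hz, hmul_neg, hmul_one]
        simp
    intro v
    exact congrArg (fun T => T v) hsq
  · rw [tz.sphere_self]
    exact hmul_mem_hline _ _
  · rw [hTu, tz.apply_I, sub_add_cancel_left]
    exact Submodule.neg_mem _ (hmul_mem_hline _ _)
  · have e := fderiv_section_sub_mem tz.diff (hT.clm_apply tz.diff) tz.psi_ne_zero
      (t.mono fun w tw => by rw [tw.sphere_self]; exact hmul_mem_hline _ _) tz.sphere_self 1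
    rw [tz.apply_I, tz.apply_one hz, ← neg_sub]
    exact Submodule.neg_mem _ e
  · rw [fderiv_sphere_self h k t, fderiv_sphere_self h k t, fderiv_y_I h k t, hq.hmul,
      tz.sphere_self, smul_hmul]
  · intro hm
    obtain ⟨a, ha⟩ := mem_hline.1 hm
    have h1 := tz.mem
    rw [ha] at h1
    have h2 := hmul_left_mem_iff tz.not_mem h1
    rw [h2, hmul_zero] at ha
    exact tz.ne_zero ha

/-- The form `ω - dY` solves the Euler-Lagrange equation of the Darboux transform. -/
lemma willmoreFormAt : WillmoreFormAt ψ (sphere S Ω ψ) (sharpForm Ω ψ) z := by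
  have hz := h.self_of_nhds
  have kz := k.self_of_nhds
  have tz := t.self_of_nhds
  have hP := tz.smooth_pot kz
  refine ⟨contDiffAt_sub_fderiv kz.smooth hP, ?_, ?_, ?_, ?_⟩
  · intro X
    exact (kz.quaternionic X).sub (isQuaternionic_fderiv (hP.differentiableAt (by simp))
      (k.mono fun w kw => isQuaternionic_darbouxY (kw.quaternionic 1)) X)
  · intro X v
    rw [sharpForm_apply h k t]
    exact Submodule.neg_mem _ (hmul_mem_hline _ _)
  · intro X
    rw [sharpForm_apply h k t, fderiv_sphere_self h k t, neg_add_cancel]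
  · exact closed_sub_fderiv kz.smooth hP kz.closed

/-- If `ω` anticommutes with `S`, then so does the form of the Darboux transform with `S♯`. -/
lemma sharpForm_anticomm (ha : ∀ᶠ w in 𝓝 z, ∀ v, Ω w 1 (S w v) = -S w (Ω w 1 v)) :
    sharpForm Ω ψ z 1 (sphere S Ω ψ z (fderiv ℝ ψ z 1)) =
      -sphere S Ω ψ z (sharpForm Ω ψ z 1 (fderiv ℝ ψ z 1)) := by
  have hz := h.self_of_nhds
  have kz := k.self_of_nhds
  have tz := t.self_of_nhds
  have hy := diff_y k t
  have hb : DifferentiableAt ℝ (b S ψ) z := (tz.smooth_b hz).differentiableAt (by simp)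
  have hq : IsQuaternionic (sphere S Ω ψ z) :=
    isQuaternionic_darbouxSphere hz.quaternionic (kz.quaternionic 1)
  have hyq : ∀ v a, fderiv ℝ (y Ω ψ) z 1 (v <• a) = fderiv ℝ (y Ω ψ) z 1 v * a := by
    intro v a
    rw [← fderiv_clm_apply_const hy, ← fderiv_clm_apply_const hy]
    have e : (fun w => y Ω ψ w (v <• a)) =ᶠ[𝓝 z] fun w => y Ω ψ w v * a :=
      k.mono fun w kw => quotForm_right (kw.quaternionic 1) v a
    rw [e.fderiv_eq, fderiv_mul_const' (hy.clm_apply (differentiableAt_const v))]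
    simp
  have hys : ∀ᶠ w in 𝓝 z, ∀ v, y Ω ψ w (S w v) = -(b S ψ w * y Ω ψ w v) := by
    filter_upwards [h, k, t, ha] with w hw kw tw haw v
    apply hmul_left_cancel tw.ne_zero
    rw [← tw.form_one kw, haw, tw.form_one kw, hw.quaternionic.hmul, tw.apply_one hw, smul_hmul,
      hmul_neg]
  -- Differentiate `y S = -β y` and apply the result to `u = dψ(∂ₓ)`.
  generalize hu : fderiv ℝ ψ z 1 = u
  have huL : u ∈ hline (φ z) := hu ▸ tz.mem
  have e1 : (fun w => y Ω ψ w (S w u)) =ᶠ[𝓝 z] fun w => -(b S ψ w * y Ω ψ w u) :=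
    hys.mono fun w hw => hw u
  have e2 := congrArg (fun T => T 1) (e1.fderiv_eq (𝕜 := ℝ))
  have hyu : DifferentiableAt ℝ (fun w => y Ω ψ w u) z := hy.clm_apply (differentiableAt_const u)
  rw [fderiv_clm_apply_vec hy (hz.diff.clm_apply (differentiableAt_const u)),
    fderiv_clm_apply_const hz.diff, fderiv_fun_neg, fderiv_fun_mul' hb hyu] at e2
  simp only [neg_apply, add_apply, smul_apply, fderiv_clm_apply_const hy, smul_eq_mul,
    MulOpposite.smul_eq_mul_unop, MulOpposite.unop_op] at e2
  have e3 : fderiv ℝ (b S ψ) z 1 = fderiv ℝ (y Ω ψ) z 1 (ψ z) + y Ω ψ z u := by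
    have : b S ψ =ᶠ[𝓝 z] fun w => y Ω ψ w (ψ w) + c := by
      filter_upwards [h, k, t] with w hw kw tw using tw.b_eq hw kw
    rw [this.fderiv_eq, fderiv_add_const, fderiv_clm_apply_vec hy tz.diff, hu]
  have e4 : y Ω ψ z (fderiv ℝ S z 1 u) = -(y Ω ψ z u * y Ω ψ z u) := by
    have hq' : IsQuaternionic (Ω z 1 + fderiv ℝ S z 1) :=
      (kz.quaternionic 1).add (SphereAt.quaternionic_fderiv h 1)
    have h1 : Ω z 1 u = -fderiv ℝ S z 1 u :=
      eq_neg_of_add_eq_zero_left (hq'.eq_zero_of_mem_hline (kz.frame 1) huL)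
    have h2 : y Ω ψ z (u <• y Ω ψ z u) = y Ω ψ z u * y Ω ψ z u :=
      quotForm_right (kz.quaternionic 1) _ _
    have h3 := tz.form_one kz u
    rw [hu] at h3
    rw [← h2, ← h3, h1, map_neg, neg_neg]
  rw [sharpForm_apply h k t, sharpForm_apply h k t, tz.sphere_of_mem huL, map_add, hyq, map_neg, hq.hmul,
    tz.sphere_self, smul_hmul, neg_neg, ← hmul_neg]
  congr 2
  rw [e4, e3] at e2
  rw [← sub_eq_zero] at e2 ⊢
  rw [← neg_eq_zero, ← e2]
  noncomm_ring

end Local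

/-- The equation `dψ = Sωψ ρ + ωψ τ` of a `∇^μ`-parallel section, where `ρ = (μ - 1)² / 4μ` and
`τ = i (μ - μ⁻¹) / 4`, can be solved for `ωψ`: it follows that `ωψ = S dψ - dψ τ/ρ`. -/
lemma of_parallel (h : SphereAt φ S z) (hψ : ContDiffAt ℝ ∞ ψ z) (hL : ψ z ∉ hline (φ z))
    (k : WillmoreFormAt φ S Ω z) (hI : ∀ v, Ω z Complex.I v = S z (Ω z 1 v)) {ρ τ : ℂ}
    (hρ : ρ ^ 2 + τ ^ 2 = -ρ)
    (hp : ∀ X, fderiv ℝ ψ z X = S z (Ω z X (ψ z)) <• (ρ : ℍ) + Ω z X (ψ z) <• (τ : ℍ))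
    (h0 : fderiv ℝ ψ z 1 ≠ 0) : TransformAt φ S Ω ψ ((τ / ρ : ℂ) : ℍ) z := by
  -- `ρ = 0` means `μ = 1`, for which `ψ` is constant.
  have hρ0 : ρ ≠ 0 := by
    rintro rfl
    apply h0
    have : τ = 0 := by simpa using hρ
    rw [hp, this]
    simp
  refine ⟨hψ, hL, ?_, ?_, h0, ?_⟩
  · rw [hp]
    exact Submodule.add_mem _ (Submodule.smul_mem _ _ (h.map_mem (k.mem _ _)))
      (Submodule.smul_mem _ _ (k.mem _ _))
  · rw [hp, hp, hI, map_add, h.quaternionic.hmul, h.quaternionic.hmul]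
  · have e := hp 1
    rw [e, map_add, h.quaternionic.hmul, h.quaternionic.hmul, h.sq, smul_add, smul_hmul,
      smul_hmul, ← Quaternion.coeComplex_mul, ← Quaternion.coeComplex_mul,
      mul_div_cancel₀ _ hρ0]
    have e2 : Ω z 1 (ψ z) = -(Ω z 1 (ψ z) <• ((ρ + τ * (τ / ρ) : ℂ) : ℍ)) := by
      have : ρ + τ * (τ / ρ) = -1 := by
        field_simp
        linear_combination hρ
      rw [this, show ((-1 : ℂ) : ℍ) = -1 by ext <;> simp, hmul_neg, hmul_one, neg_neg]
    rw [Quaternion.coeComplex_add, hmul_add] at e2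
    rw [smul_neg]
    conv_lhs => rw [e2]
    abel

end TransformAt


/-! ### Passing to a chart -/

section Charts

variable {M : Type*} [TopologicalSpace M] [ChartedSpace ℂ M] [IsManifold 𝓘(ℂ) ω M]
variable {E : Type*} [NormedAddCommGroup E] [NormedSpace ℝ E]
  {e : OpenPartialHomeomorph M ℂ} {z : ℂ}

/-- A Riemann surface is a smooth real surface. -/
instance isManifold_real : IsManifold 𝓘(ℝ, ℂ) ∞ M := by
  refine isManifold_of_contDiffOn _ _ _ fun e e' he he' => ?_
  have h := (contDiffGroupoid ω 𝓘(ℂ)).compatible he he'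
  rw [contDiffGroupoid, mem_groupoid_of_pregroupoid] at h
  have h1 : ContDiffOn ℂ ω (𝓘(ℂ) ∘ e.symm ≫ₕ e' ∘ 𝓘(ℂ).symm)
      (𝓘(ℂ).symm ⁻¹' (e.symm ≫ₕ e').source ∩ range 𝓘(ℂ)) := h.1
  exact (h1.restrict_scalars ℝ).of_le le_top

/-- The tangent vector with coordinate expression `X` at `z` in the chart `e`. -/
def chartD (e : OpenPartialHomeomorph M ℂ) (z X : ℂ) : Tan (e.symm z) :=
  mfderiv 𝓘(ℝ, ℂ) 𝓘(ℝ, ℂ) e.symm z X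

omit [IsManifold 𝓘(ℂ) ω M] in
lemma inChart_apply (α : OneForm M E) (X : ℂ) :
    inChart e α z X = α (e.symm z) (chartD e z X) := rfl

variable (he : e ∈ atlas ℂ M) (hz : z ∈ e.target)
include he hz

lemma mdifferentiableAt_chart_symm : MDifferentiableAt 𝓘(ℝ, ℂ) 𝓘(ℝ, ℂ) e.symm z := by
  have : IsManifold 𝓘(ℝ, ℂ) 1 M := IsManifold.of_le (n := ∞) (by simp)
  exact mdifferentiableAt_atlas_symm he hz

lemma chartD_bijective : Function.Bijective (chartD e z) := by
  have : IsManifold 𝓘(ℝ, ℂ) 1 M := IsManifold.of_le (n := ∞) (by simp)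
  have h : e.MDifferentiable 𝓘(ℝ, ℂ) 𝓘(ℝ, ℂ) := mdifferentiable_of_mem_atlas he
  exact h.symm.mfderiv_bijective hz

/-- Charts are holomorphic. -/
lemma chartD_I (X : ℂ) :
    chartD e z (Complex.I * X) = tanJ (e.symm z) (chartD e z X) := by
  have : IsManifold 𝓘(ℂ) 1 M := IsManifold.of_le (n := ω) le_top
  have h : MDifferentiableAt 𝓘(ℂ) 𝓘(ℂ) e.symm z := mdifferentiableAt_atlas_symm he hz
  have h1 := h.hasMFDerivAt
  have h2 : HasMFDerivAt 𝓘(ℝ, ℂ) 𝓘(ℝ, ℂ) e.symm z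
      ((mfderiv 𝓘(ℂ) 𝓘(ℂ) e.symm z : ℂ →L[ℂ] ℂ).restrictScalars ℝ) :=
    ⟨h1.1, h1.2.restrictScalars ℝ⟩
  unfold chartD
  rw [h2.mfderiv]
  exact map_smul (mfderiv 𝓘(ℂ) 𝓘(ℂ) e.symm z : ℂ →L[ℂ] ℂ) Complex.I X

lemma fderiv_comp_chart_symm {F : M → E} (hF : ContMDiffAt 𝓘(ℝ, ℂ) 𝓘(ℝ, E) ∞ F (e.symm z))
    (X : ℂ) : fderiv ℝ (fun w => F (e.symm w)) z X =
      diff F (e.symm z) (chartD e z X) := by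
  have h := mfderiv_comp z (hF.mdifferentiableAt (by simp)) (mdifferentiableAt_chart_symm he hz)
  rw [mfderiv_eq_fderiv] at h
  exact congrArg (fun T : ℂ →L[ℝ] E => T X) h

lemma contDiffAt_comp_chart_symm {F : M → E}
    (hF : ContMDiffAt 𝓘(ℝ, ℂ) 𝓘(ℝ, E) ∞ F (e.symm z)) :
    ContDiffAt ℝ ∞ (fun w => F (e.symm w)) z :=
  (hF.comp z (contMDiffAt_symm_of_mem_maximalAtlas
    (IsManifold.subset_maximalAtlas he) hz)).contDiffAt

lemma contMDiffAt_of_comp_chart_symm {F : M → E}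
    (hF : ContDiffAt ℝ ∞ (fun w => F (e.symm w)) z) :
    ContMDiffAt 𝓘(ℝ, ℂ) 𝓘(ℝ, E) ∞ F (e.symm z) := by
  have hs : e.symm z ∈ e.source := e.map_target hz
  have h1 : ContMDiffAt 𝓘(ℝ, ℂ) 𝓘(ℝ, E) ∞ ((fun w => F (e.symm w)) ∘ e) (e.symm z) := by
    refine ContMDiffAt.comp _ ?_ (contMDiffAt_of_mem_maximalAtlas
      (IsManifold.subset_maximalAtlas he) hs)
    rw [e.right_inv hz]
    exact hF.contMDiffAt
  refine h1.congr_of_eventuallyEq ?_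
  filter_upwards [e.open_source.mem_nhds hs] with q hq
  simp [e.left_inv hq]

omit [ChartedSpace ℂ M] [IsManifold 𝓘(ℂ) ω M] he in
lemma eventually_chart_symm {P : M → Prop} (h : ∀ᶠ q in 𝓝 (e.symm z), P q) :
    ∀ᶠ w in 𝓝 z, w ∈ e.target ∧ P (e.symm w) :=
  Filter.Eventually.and (e.open_target.mem_nhds hz) ((e.continuousAt_symm hz).eventually h)

lemma inChart_starForm (α : OneForm M E) (X : ℂ) :
    inChart e (starForm α) z X = inChart e α z (Complex.I * X) := by
  rw [inChart_apply, inChart_apply, chartD_I he hz]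
  rfl

lemma inChart_diff {F : M → E} (hF : ContMDiffAt 𝓘(ℝ, ℂ) 𝓘(ℝ, E) ∞ F (e.symm z)) (X : ℂ) :
    inChart e (diff F) z X = fderiv ℝ (fun w => F (e.symm w)) z X :=
  (fderiv_comp_chart_symm he hz hF X).symm

lemma inChart_hopfA {S : M → EndV} (hS : ContMDiffAt 𝓘(ℝ, ℂ) 𝓘(ℝ, EndV) ∞ S (e.symm z)) (X : ℂ) :
    inChart e (hopfA S) z X = (1 / 4 : ℝ) • ((S (e.symm z)).comp
      (fderiv ℝ (fun w => S (e.symm w)) z X) +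
        fderiv ℝ (fun w => S (e.symm w)) z (Complex.I * X)) := by
  rw [fderiv_comp_chart_symm he hz hS, fderiv_comp_chart_symm he hz hS,
    chartD_I he hz]
  rfl

lemma inChart_hopfQ {S : M → EndV} (hS : ContMDiffAt 𝓘(ℝ, ℂ) 𝓘(ℝ, EndV) ∞ S (e.symm z)) (X : ℂ) :
    inChart e (hopfQ S) z X = (1 / 4 : ℝ) • ((S (e.symm z)).comp
      (fderiv ℝ (fun w => S (e.symm w)) z X) -
        fderiv ℝ (fun w => S (e.symm w)) z (Complex.I * X)) := by
  rw [fderiv_comp_chart_symm he hz hS, fderiv_comp_chart_symm he hz hS,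
    chartD_I he hz]
  rfl

end Charts


/-! ### Sections and mean curvature spheres in a chart -/

section Translation

variable {M : Type*} [TopologicalSpace M] [ChartedSpace ℂ M]
  {f : M → HP1} {U : Set M}

omit [TopologicalSpace M] [ChartedSpace ℂ M] in
lemma line_eq_hline {p : M} {v : V} (hv : v ∈ line f p) (h0 : v ≠ 0) : line f p = hline v := by
  have h : line f p = hline (f p).rep := (f p).submodule_eq
  rw [h] at hv ⊢
  exact (hline_eq_of_mem hv h0).symm

lemma IsSectionNear.eventually {p : M} {φ : M → V} (h : IsSectionNear f p φ) :
    ∀ᶠ q in 𝓝 p, IsSectionNear f q φ := eventually_eventually_nhds.2 h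

/-- A frame of the line bundle has no zeros nearby, and spans the line bundle there. -/
lemma IsSectionNear.eventually_frame {φ : M → V} {p : M} (h : IsSectionNear f p φ)
    (h0 : φ p ≠ 0) : ∀ᶠ q in 𝓝 p, φ q ≠ 0 ∧ line f q = hline (φ q) := by
  have hc : ContinuousAt φ p := h.self_of_nhds.1.continuousAt
  filter_upwards [h, hc.eventually_ne h0] with q hq hq0
  exact ⟨hq0, line_eq_hline hq.2 hq0⟩

lemma IsMeanCurvatureSphereOn.contMDiffAt {S : M → EndV} (hS : IsMeanCurvatureSphereOn f S U)
    (hU : IsOpen U) {p : M} (hp : p ∈ U) : ContMDiffAt 𝓘(ℝ, ℂ) 𝓘(ℝ, EndV) ∞ S p :=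
  hS.smooth.contMDiffAt (hU.mem_nhds hp)

variable [IsManifold 𝓘(ℂ) ω M] {e : OpenPartialHomeomorph M ℂ} {z : ℂ}

lemma IsSectionNear.chart {φ : M → V} (he : e ∈ atlas ℂ M) (hz : z ∈ e.target)
    (h : IsSectionNear f (e.symm z) φ) :
    ∀ᶠ w in 𝓝 z, ContDiffAt ℝ ∞ (fun w => φ (e.symm w)) w ∧ φ (e.symm w) ∈ line f (e.symm w) :=
  (eventually_chart_symm hz h).mono fun _ hw =>
    ⟨contDiffAt_comp_chart_symm he hw.1 hw.2.1, hw.2.2⟩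

lemma IsSectionNear.contDiffAt {φ : M → V} (he : e ∈ atlas ℂ M) (hz : z ∈ e.target)
    (h : IsSectionNear f (e.symm z) φ) : ContDiffAt ℝ ∞ (fun w => φ (e.symm w)) z :=
  (h.chart he hz).self_of_nhds.1

lemma IsSectionNear.fderiv_sub_mem {φ χ : M → V} (he : e ∈ atlas ℂ M) (hz : z ∈ e.target)
    (hφ : IsSectionNear f (e.symm z) φ) (h0 : φ (e.symm z) ≠ 0)
    (hχ : IsSectionNear f (e.symm z) χ) {t : ℍ} (ht : χ (e.symm z) = φ (e.symm z) <• t) (X : ℂ) :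
    fderiv ℝ (fun w => χ (e.symm w)) z X - fderiv ℝ (fun w => φ (e.symm w)) z X <• t ∈
      hline (φ (e.symm z)) := by
  refine fderiv_section_sub_mem (φ := fun w => φ (e.symm w)) (v := fun w => χ (e.symm w))
    ((hφ.contDiffAt he hz).differentiableAt (by simp))
    ((hχ.contDiffAt he hz).differentiableAt (by simp)) h0 ?_ ht X
  filter_upwards [hχ.chart he hz, eventually_chart_symm hz (hφ.eventually_frame h0)] with w hw hw'
  rw [← hw'.2.2]
  exact hw.2

/-- It suffices to test immersedness on a frame, since `δ` is quaternionic linear. -/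
lemma fderiv_frame_notMem {φ : M → V} (he : e ∈ atlas ℂ M) (hz : z ∈ e.target)
    (hφ : IsSectionNear f (e.symm z) φ) (h0 : φ (e.symm z) ≠ 0)
    (hi : IsImmersedAt f (e.symm z)) :
    fderiv ℝ (fun w => φ (e.symm w)) z 1 ∉ hline (φ (e.symm z)) := by
  intro h
  have hl := (hφ.eventually_frame h0).self_of_nhds.2
  have h1 : chartD e z 1 = 0 := by
    refine hi _ fun χ hχ => ?_
    have hm := hχ.self_of_nhds.2
    rw [hl] at hm ⊢
    obtain ⟨t, ht⟩ := mem_hline.1 hm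
    have h2 := hφ.fderiv_sub_mem he hz h0 hχ ht 1
    rw [← fderiv_comp_chart_symm he hz hχ.self_of_nhds.1]
    have h3 := Submodule.add_mem _ h2 (Submodule.smul_mem _ (MulOpposite.op t) h)
    rwa [sub_add_cancel] at h3
  have h4 : chartD e z 0 = 0 := map_zero (mfderiv 𝓘(ℝ, ℂ) 𝓘(ℝ, ℂ) e.symm z)
  exact one_ne_zero ((chartD_bijective he hz).1 (h1.trans h4.symm))

lemma IsMeanCurvatureSphereOn.section_apply {S : M → EndV} (hS : IsMeanCurvatureSphereOn f S U)
    (hU : IsOpen U) {p : M} (hp : p ∈ U) {φ : M → V} (hφ : IsSectionNear f p φ) :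
    IsSectionNear f p fun q => S q (φ q) := by
  filter_upwards [hφ, hU.mem_nhds hp] with q hq hqU
  refine ⟨?_, hS.maps_line q hqU _ hq.2⟩
  have hs : (chartAt ℂ q).symm (chartAt ℂ q q) = q := (chartAt ℂ q).left_inv (mem_chart_source ℂ q)
  have ht := mem_chart_target ℂ q
  have h1 := hS.contMDiffAt hU hqU
  have h2 := hq.1
  rw [← hs] at h1 h2 ⊢
  exact contMDiffAt_of_comp_chart_symm (chart_mem_atlas ℂ q) ht
    ((contDiffAt_comp_chart_symm (chart_mem_atlas ℂ q) ht h1).clm_apply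
      (contDiffAt_comp_chart_symm (chart_mem_atlas ℂ q) ht h2))

lemma IsMeanCurvatureSphereOn.sphereAt {S : M → EndV} (hS : IsMeanCurvatureSphereOn f S U)
    (hU : IsOpen U) (hi : ∀ p ∈ U, IsImmersedAt f p) (he : e ∈ atlas ℂ M) (hz : z ∈ e.target)
    (hp : e.symm z ∈ U) {φ : M → V} (hφ : IsSectionNear f (e.symm z) φ)
    (h0 : φ (e.symm z) ≠ 0) :
    SphereAt (fun w => φ (e.symm w)) (fun w => S (e.symm w)) z := by
  have hl := (hφ.eventually_frame h0).self_of_nhds.2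
  have hs := hS.contMDiffAt hU hp
  have hSφ := hS.section_apply hU hp hφ
  refine ⟨hφ.contDiffAt he hz, contDiffAt_comp_chart_symm he hz hs, h0, hS.quaternionic _ hp,
    hS.sq _ hp, ?_, ?_, ?_, ?_, fderiv_frame_notMem he hz hφ h0 (hi _ hp)⟩
  · rw [← hl]
    exact hS.maps_line _ hp _ hφ.self_of_nhds.2
  · have := hS.star_eq_left _ hp φ hφ (chartD e z 1)
    rw [hl, ← chartD_I he hz, ← fderiv_comp_chart_symm he hz hφ.self_of_nhds.1,
      ← fderiv_comp_chart_symm he hz hφ.self_of_nhds.1, mul_one] at this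
    exact this
  · have := hS.star_eq_right _ hp φ hφ (chartD e z 1)
    rw [hl, ← chartD_I he hz, ← fderiv_comp_chart_symm he hz hφ.self_of_nhds.1,
      ← fderiv_comp_chart_symm he hz hSφ.self_of_nhds.1, mul_one] at this
    exact this
  · have := hS.hopfQ_line _ hp (chartD e z 1) _ hφ.self_of_nhds.2
    rw [← inChart_apply, inChart_hopfQ he hz hs, mul_one, smul_apply, smul_eq_zero, sub_apply,
      sub_eq_zero] at this
    exact this.resolve_left (by norm_num)

lemma IsMeanCurvatureSphereOn.eventually_sphereAt {S : M → EndV}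
    (hS : IsMeanCurvatureSphereOn f S U) (hU : IsOpen U) (hi : ∀ p ∈ U, IsImmersedAt f p)
    (he : e ∈ atlas ℂ M) (hz : z ∈ e.target) (hp : e.symm z ∈ U) {φ : M → V}
    (hφ : IsSectionNear f (e.symm z) φ) (h0 : φ (e.symm z) ≠ 0) :
    ∀ᶠ w in 𝓝 z, SphereAt (fun w => φ (e.symm w)) (fun w => S (e.symm w)) w := by
  filter_upwards [eventually_chart_symm hz (hφ.eventually_frame h0),
    eventually_chart_symm hz hφ.eventually, eventually_chart_symm hz (hU.mem_nhds hp)]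
    with w h1 h2 h3
  exact hS.sphereAt hU hi he h1.1 h3.2 h2.2 h1.2.1

/-- The mean curvature sphere conditions can be checked in charts, for a single local frame of the
line bundle. -/
lemma isMeanCurvatureSphereOn_of_chart {S : M → EndV}
    (H : ∀ p ∈ U, ∃ e ∈ atlas ℂ M, ∃ z ∈ e.target, e.symm z = p ∧ ∃ φ, IsSectionNear f p φ ∧
      ∀ᶠ w in 𝓝 z, SphereAt (fun w => φ (e.symm w)) (fun w => S (e.symm w)) w) :
    IsMeanCurvatureSphereOn f S U := by
  have hs : ∀ p ∈ U, ContMDiffAt 𝓘(ℝ, ℂ) 𝓘(ℝ, EndV) ∞ S p := by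
    intro p hp
    obtain ⟨e, he, z, hz, rfl, φ, hφ, h⟩ := H p hp
    exact contMDiffAt_of_comp_chart_symm he hz h.self_of_nhds.smooth
  refine ⟨fun p hp => (hs p hp).contMDiffWithinAt, fun p hp => ?_, fun p hp => ?_, fun p hp => ?_,
    fun p hp χ hχ X => ?_, fun p hp χ hχ X => ?_, fun p hp X v hv => ?_⟩ <;>
  obtain ⟨e, he, z, hz, rfl, φ, hφ, h⟩ := H p hp <;>
  have a := h.self_of_nhds <;>
  have h0 : φ (e.symm z) ≠ 0 := a.ne_zero <;>
  have hl := (hφ.eventually_frame h0).self_of_nhds.2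
  · exact a.quaternionic
  · exact a.sq
  · intro v hv
    rw [hl] at hv ⊢
    exact a.map_mem hv
  · obtain ⟨Z, rfl⟩ := (chartD_bijective he hz).2 X
    have hm := hχ.self_of_nhds.2
    rw [hl] at hm ⊢
    obtain ⟨t, ht⟩ := mem_hline.1 hm
    have hd := hφ.fderiv_sub_mem he hz h0 hχ ht
    have h1 : fderiv ℝ (fun w => χ (e.symm w)) z Complex.I -
        S (e.symm z) (fderiv ℝ (fun w => χ (e.symm w)) z 1) ∈ hline (φ (e.symm z)) := by
      have e1 := Submodule.smul_mem _ (MulOpposite.op t) a.left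
      have e2 := a.map_mem (hd 1)
      rw [map_sub, a.quaternionic.hmul] at e2
      rw [smul_sub] at e1
      have := Submodule.sub_mem _ (Submodule.add_mem _ (hd Complex.I) e1) e2
      rwa [sub_add_sub_cancel, sub_sub_sub_cancel_right] at this
    rw [← chartD_I he hz, ← fderiv_comp_chart_symm he hz hχ.self_of_nhds.1,
      ← fderiv_comp_chart_symm he hz hχ.self_of_nhds.1]
    generalize fderiv ℝ (fun w => χ (e.symm w)) z = T at h1 ⊢
    -- The conditions at `∂ₓ` and `∂_y` are equivalent, because `S² = -1`.
    have h2 : T (Complex.I * Z) - S (e.symm z) (T Z) = Z.re • (T Complex.I - S (e.symm z) (T 1))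
        - Z.im • S (e.symm z) (T Complex.I - S (e.symm z) (T 1)) := by
      rw [map_sub, a.sq, clm_eq_re_im T (Complex.I * Z), clm_eq_re_im T Z]
      simp only [Complex.I_mul_re, Complex.I_mul_im, map_add, map_smul]
      module
    rw [h2]
    exact Submodule.sub_mem _ (Submodule.smul_of_tower_mem _ _ h1)
      (Submodule.smul_of_tower_mem _ _ (a.map_mem h1))
  · obtain ⟨Z, rfl⟩ := (chartD_bijective he hz).2 X
    have hm := hχ.self_of_nhds.2
    rw [hl] at hm ⊢
    obtain ⟨t, ht⟩ := mem_hline.1 hm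
    obtain ⟨β, hβ⟩ := mem_hline.1 a.maps
    have hd := hφ.fderiv_sub_mem he hz h0 hχ ht
    have hSχ : ContDiffAt ℝ ∞ (fun w => S (e.symm w) (χ (e.symm w))) z :=
      a.smooth.clm_apply (hχ.contDiffAt he hz)
    have hSχ' : ContMDiffAt 𝓘(ℝ, ℂ) 𝓘(ℝ, V) ∞ (fun q => S q (χ q)) (e.symm z) :=
      contMDiffAt_of_comp_chart_symm he hz hSχ
    have hev : ∀ᶠ w in 𝓝 z, S (e.symm w) (χ (e.symm w)) ∈ hline (φ (e.symm w)) := by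
      filter_upwards [h, hχ.chart he hz, eventually_chart_symm hz (hφ.eventually_frame h0)]
        with w hw1 hw2 hw3
      refine hw1.map_mem ?_
      rw [← hw3.2.2]
      exact hw2.2
    have hβt : S (e.symm z) (χ (e.symm z)) = φ (e.symm z) <• (β * t) := by
      rw [ht, a.quaternionic.hmul, hβ, smul_hmul]
    have hd2 := fderiv_section_sub_mem a.diff_frame (hSχ.differentiableAt (by simp)) a.ne_zero hev
      hβt
    have hd3 := fderiv_section_sub_mem a.diff_frame (a.diff.clm_apply a.diff_frame) a.ne_zero
      (h.mono fun w hw => hw.maps) hβ 1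
    have hy : fderiv ℝ (fun w => φ (e.symm w)) z Complex.I -
        fderiv ℝ (fun w => φ (e.symm w)) z 1 <• β ∈ hline (φ (e.symm z)) := by
      have := Submodule.add_mem _ a.right hd3
      rwa [sub_add_sub_cancel] at this
    have hββ : β * β = -1 := by
      apply hmul_left_cancel a.ne_zero
      rw [← smul_hmul, ← hβ, ← a.quaternionic.hmul, ← hβ, a.sq, hmul_neg, hmul_one]
    rw [← chartD_I he hz, ← fderiv_comp_chart_symm he hz hχ.self_of_nhds.1,
      ← fderiv_comp_chart_symm he hz hSχ']
    have h1 : fderiv ℝ (fun w => χ (e.symm w)) z Complex.I -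
        fderiv ℝ (fun w => S (e.symm w) (χ (e.symm w))) z 1 ∈ hline (φ (e.symm z)) := by
      have e1 := Submodule.smul_mem _ (MulOpposite.op t) hy
      rw [smul_sub, smul_hmul] at e1
      have := Submodule.sub_mem _ (Submodule.add_mem _ (hd Complex.I) e1) (hd2 1)
      rwa [sub_add_sub_cancel, sub_sub_sub_cancel_right] at this
    have h2 : fderiv ℝ (fun w => χ (e.symm w)) z 1 +
        fderiv ℝ (fun w => S (e.symm w) (χ (e.symm w))) z Complex.I ∈ hline (φ (e.symm z)) := by
      have e1 := Submodule.smul_mem _ (MulOpposite.op (β * t)) hy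
      rw [smul_sub, smul_hmul, ← mul_assoc, hββ, neg_one_mul, hmul_neg, sub_neg_eq_add] at e1
      have := Submodule.add_mem _ (Submodule.add_mem _ (hd 1) e1) (hd2 Complex.I)
      convert this using 1
      abel
    generalize fderiv ℝ (fun w => χ (e.symm w)) z = T at h1 h2 ⊢
    generalize fderiv ℝ (fun w => S (e.symm w) (χ (e.symm w))) z = T' at h1 h2 ⊢
    have h3 : T (Complex.I * Z) - T' Z = Z.re • (T Complex.I - T' 1)
        - Z.im • (T 1 + T' Complex.I) := by
      rw [clm_eq_re_im T (Complex.I * Z), clm_eq_re_im T' Z]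
      simp only [Complex.I_mul_re, Complex.I_mul_im]
      module
    rw [h3]
    exact Submodule.sub_mem _ (Submodule.smul_of_tower_mem _ _ h1)
      (Submodule.smul_of_tower_mem _ _ h2)
  · obtain ⟨Z, rfl⟩ := (chartD_bijective he hz).2 X
    rw [hl] at hv
    have hq := SphereAt.quaternionic_fderiv h
    have h1 : fderiv ℝ (fun w => S (e.symm w)) z Complex.I v =
        S (e.symm z) (fderiv ℝ (fun w => S (e.symm w)) z 1 v) := by
      have hq2 := (hq Complex.I).sub (a.quaternionic.comp (hq 1))
      have := hq2.eq_zero_of_mem_hline (w := φ (e.symm z))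
        (by rw [sub_apply, ContinuousLinearMap.comp_apply, a.hopfQ, sub_self]) hv
      rwa [sub_apply, sub_eq_zero] at this
    rw [← inChart_apply, inChart_hopfQ he hz (hs _ hp)]
    have hT := clm_eq_re_im (E := EndV) (fderiv ℝ (fun w => S (e.symm w)) z)
    generalize fderiv ℝ (fun w => S (e.symm w)) z = T at h1 hT ⊢
    rw [hT (Complex.I * Z), hT Z]
    simp only [Complex.I_mul_re, Complex.I_mul_im, smul_apply, sub_apply, add_apply,
      ContinuousLinearMap.comp_apply, map_add, map_smul, h1, a.sq]
    module

/-- A surface with a mean curvature sphere congruence is conformal: the complex structures on `L`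
and `V/L` are those induced by `S`. -/
lemma IsMeanCurvatureSphereOn.isConformalImmersionOn {S : M → EndV}
    (hS : IsMeanCurvatureSphereOn f S U) (hU : IsOpen U) (hf : IsSmoothMapOn f U)
    (hi : ∀ p ∈ U, IsImmersedAt f p) : IsConformalImmersionOn f U := by
  refine ⟨hf, hi, fun p hp => ?_⟩
  let T : V →ₗ[ℍᵐᵒᵖ] V :=
    { toFun := S p
      map_add' := map_add _
      map_smul' := fun a v => hS.quaternionic p hp v a.unop }
  have hT : ∀ v ∈ line f p, T v ∈ line f p := hS.maps_line p hp
  refine ⟨T.restrict hT, (line f p).mapQ (line f p) T hT, ?_, ?_, ?_, ?_⟩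
  · intro v
    ext1
    exact hS.sq p hp v
  · intro w
    obtain ⟨v, rfl⟩ := Submodule.mkQ_surjective _ w
    rw [Submodule.mkQ_apply, Submodule.mapQ_apply, Submodule.mapQ_apply,
      ← Submodule.Quotient.mk_neg]
    congr 1
    exact hS.sq p hp v
  · -- The sections `χ` and `Sφ` agree at `p`, hence so do `δχ` and `δ(Sφ)`.
    intro φ χ hφ hχ hJ X
    have hχp : χ p = S p (φ p) := hJ hφ.self_of_nhds.2
    rw [← sub_eq_zero, ← map_sub, Submodule.mkQ_apply, Submodule.Quotient.mk_eq_zero]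
    have h1 := hS.star_eq_right p hp φ hφ X
    have hSφ := hS.section_apply hU hp hφ
    obtain ⟨σ, hσ, h0⟩ := hf p hp
    have hl := (hσ.eventually_frame h0).self_of_nhds.2
    have he := chart_mem_atlas ℂ p
    have hz := mem_chart_target ℂ p
    have hs : (chartAt ℂ p).symm (chartAt ℂ p p) = p :=
      (chartAt ℂ p).left_inv (mem_chart_source ℂ p)
    generalize chartAt ℂ p = e at he hz hs
    generalize e p = z at hz hs
    subst hs
    obtain ⟨Z, rfl⟩ := (chartD_bijective he hz).2 X
    have hm := hχ.self_of_nhds.2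
    rw [hl] at hm h1 ⊢
    obtain ⟨t, ht⟩ := mem_hline.1 hm
    have h2 := hσ.fderiv_sub_mem he hz h0 hχ ht Z
    have h3 := hσ.fderiv_sub_mem he hz h0 hSφ (hχp.symm.trans ht) Z
    rw [fderiv_comp_chart_symm he hz hχ.self_of_nhds.1] at h2
    rw [fderiv_comp_chart_symm he hz hSφ.self_of_nhds.1] at h3
    have := Submodule.sub_mem _ (Submodule.add_mem _ h1 h3) h2
    rwa [sub_add_sub_cancel, sub_sub_sub_cancel_right] at this
  · intro φ hφ X
    rw [← sub_eq_zero, Submodule.mkQ_apply, Submodule.mkQ_apply, Submodule.mapQ_apply,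
      ← Submodule.Quotient.mk_sub, Submodule.Quotient.mk_eq_zero]
    exact hS.star_eq_left p hp φ hφ X

end Translation


/-! ### The Euler-Lagrange equation in a chart -/

/-- The form `2⋆A` of a congruence `S` in a coordinate, evaluated at the vector `X`. -/
def hopfForm (S : ℂ → EndV) (z X : ℂ) : EndV :=
  (1 / 2 : ℝ) • ((S z).comp (fderiv ℝ S z (Complex.I * X)) - fderiv ℝ S z X)

lemma hopfForm_apply (S : ℂ → EndV) (z X : ℂ) (v : V) : hopfForm S z X v =
    (1 / 2 : ℝ) • (S z (fderiv ℝ S z (Complex.I * X) v) - fderiv ℝ S z X v) := rfl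

lemma hopfForm_eq_re_im (S : ℂ → EndV) (z X : ℂ) (v : V) :
    hopfForm S z X v = X.re • hopfForm S z 1 v + X.im • hopfForm S z Complex.I v := by
  have hT := clm_eq_re_im (E := EndV) (fderiv ℝ S z)
  simp only [hopfForm_apply]
  generalize fderiv ℝ S z = T at hT ⊢
  rw [hT (Complex.I * X), hT X, hT (Complex.I * 1), hT (Complex.I * Complex.I)]
  simp only [Complex.I_mul_re, Complex.I_mul_im, Complex.one_re, Complex.one_im, Complex.I_re,
    Complex.I_im, add_apply, smul_apply, map_add, map_smul]
  module

section HopfForm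

variable {φ : ℂ → V} {S : ℂ → EndV} {z : ℂ}

lemma hopfForm_one : hopfForm S z 1 =
    (1 / 2 : ℝ) • ((S z).comp (fderiv ℝ S z Complex.I) - fderiv ℝ S z 1) := by
  rw [hopfForm, mul_one]

lemma hopfForm_I : hopfForm S z Complex.I =
    (1 / 2 : ℝ) • (-(S z).comp (fderiv ℝ S z 1) - fderiv ℝ S z Complex.I) := by
  rw [hopfForm, Complex.I_mul_I, map_neg, ContinuousLinearMap.comp_neg]

lemma contDiffAt_hopfForm (hS : ContDiffAt ℝ ∞ S z) (X : ℂ) :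
    ContDiffAt ℝ ∞ (fun w => hopfForm S w X) z :=
  ContDiffAt.const_smul (F := V →L[ℝ] V) _
    (ContDiffAt.sub (F := V →L[ℝ] V)
      (ContDiffAt.clm_comp (E := V) (F := V) (G := V) hS (contDiffAt_fderiv_apply hS _))
      (contDiffAt_fderiv_apply hS _))

variable (h : ∀ᶠ w in 𝓝 z, SphereAt φ S w)
include h

lemma isQuaternionic_hopfForm (X : ℂ) : IsQuaternionic (hopfForm S z X) :=
  ((h.self_of_nhds.quaternionic.comp (SphereAt.quaternionic_fderiv h _)).sub
    (SphereAt.quaternionic_fderiv h _)).real_smul _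

lemma hopfForm_mem (X : ℂ) (v : V) : hopfForm S z X v ∈ hline (φ z) := by
  have hz := h.self_of_nhds
  have hm := SphereAt.hopfA_mem h v
  rw [hopfForm_eq_re_im]
  refine Submodule.add_mem _ (Submodule.smul_of_tower_mem _ _ ?_)
    (Submodule.smul_of_tower_mem _ _ ?_)
  · rw [hopfForm_one]
    have := hz.map_mem hm
    rw [map_add, hz.sq] at this
    exact Submodule.smul_of_tower_mem _ (1 / 2 : ℝ) (by simpa [sub_eq_add_neg] using this)
  · rw [hopfForm_I]
    refine Submodule.smul_of_tower_mem _ (1 / 2 : ℝ) ?_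
    have := Submodule.neg_mem _ hm
    rwa [neg_add_rev] at this

lemma hopfForm_frame (X : ℂ) : hopfForm S z X (φ z) + fderiv ℝ S z X (φ z) = 0 := by
  have hz := h.self_of_nhds
  have hQ := hz.hopfQ
  have hT := clm_eq_re_im (E := EndV) (fderiv ℝ S z) X
  rw [hT, hopfForm_eq_re_im, hopfForm_one, hopfForm_I]
  simp only [add_apply, smul_apply, sub_apply, neg_apply, ContinuousLinearMap.comp_apply]
  rw [← hQ, hz.sq]
  module

end HopfForm

section Calculus

variable {E : Type*} [NormedAddCommGroup E] [NormedSpace ℝ E] {z : ℂ}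

lemma contDiffAt_planeForm {Ω : PlaneForm E} (h1 : ContDiffAt ℝ ∞ (fun w => Ω w 1) z)
    (hI : ContDiffAt ℝ ∞ (fun w => Ω w Complex.I) z) : ContDiffAt ℝ ∞ Ω z := by
  have h : Ω = fun w => ContinuousLinearMap.smulRightL ℝ ℂ E Complex.reCLM (Ω w 1) +
      ContinuousLinearMap.smulRightL ℝ ℂ E Complex.imCLM (Ω w Complex.I) := by
    funext w
    ext1 X
    rw [clm_eq_re_im (Ω w) X]
    rfl
  rw [h]
  exact (contDiffAt_clm_comp _ h1).add (contDiffAt_clm_comp _ hI)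

lemma fderiv_real_smul (r : ℝ) (Ω : PlaneForm E) :
    fderiv ℝ (fun w => r • Ω w) z = r • fderiv ℝ Ω z := by
  exact congrFun (fderiv_const_smul_field (𝕜 := ℝ) (f := Ω) r) z

end Calculus

section Translation

variable {M : Type*} [TopologicalSpace M] [ChartedSpace ℂ M]

/-- The form `2⋆A + η`. -/
def totalForm (S : M → EndV) (η : OneForm M EndV) : OneForm M EndV :=
  fun p => (2 : ℝ) • starForm (hopfA S) p + η p

lemma isClosedFormOn_real_smul_iff {E : Type*} [NormedAddCommGroup E] [NormedSpace ℝ E]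
    {α : OneForm M E} {U : Set M} {r : ℝ} (hr : r ≠ 0) :
    IsClosedFormOn (fun p => r • α p) U ↔ IsClosedFormOn α U := by
  refine forall₂_congr fun e _ => forall₂_congr fun z _ => ?_
  have h : inChart e (fun p => r • α p) = fun w => r • inChart e α w := rfl
  rw [h, fderiv_real_smul]
  simp only [smul_apply]
  exact (smul_right_injective E hr).eq_iff

variable [IsManifold 𝓘(ℂ) ω M] {e : OpenPartialHomeomorph M ℂ} {z : ℂ} {f : M → HP1} {U : Set M}

lemma inChart_two_star_hopfA {S : M → EndV} (he : e ∈ atlas ℂ M) (hz : z ∈ e.target)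
    (hS : ContMDiffAt 𝓘(ℝ, ℂ) 𝓘(ℝ, EndV) ∞ S (e.symm z)) (X : ℂ) :
    inChart e (fun p => (2 : ℝ) • starForm (hopfA S) p) z X =
      hopfForm (fun w => S (e.symm w)) z X := by
  change (2 : ℝ) • inChart e (starForm (hopfA S)) z X = _
  rw [inChart_starForm he hz, inChart_hopfA he hz hS, ← mul_assoc, Complex.I_mul_I, neg_one_mul,
    map_neg, hopfForm, smul_smul, ← sub_eq_add_neg]
  norm_num

lemma inChart_totalForm {S : M → EndV} {η : OneForm M EndV} (he : e ∈ atlas ℂ M)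
    (hz : z ∈ e.target) (hS : ContMDiffAt 𝓘(ℝ, ℂ) 𝓘(ℝ, EndV) ∞ S (e.symm z)) (X : ℂ) :
    inChart e (totalForm S η) z X =
      hopfForm (fun w => S (e.symm w)) z X + inChart e η z X := by
  rw [← inChart_two_star_hopfA he hz hS]
  rfl

/-- The form `2⋆A + η` of a constrained Willmore surface, in a chart. -/
lemma IsLagrangeMultiplierOn.willmoreFormAt {S : M → EndV} {η : OneForm M EndV}
    (hη : IsLagrangeMultiplierOn f S η U) (hS : IsMeanCurvatureSphereOn f S U) (hU : IsOpen U)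
    (he : e ∈ atlas ℂ M) (hz : z ∈ e.target) (hp : e.symm z ∈ U) {φ : ℂ → V}
    (hl : line f (e.symm z) = hline (φ z))
    (h : ∀ᶠ w in 𝓝 z, SphereAt φ (fun w => S (e.symm w)) w) :
    WillmoreFormAt φ (fun w => S (e.symm w)) (inChart e (totalForm S η)) z := by
  have hs := hS.contMDiffAt hU hp
  have ha := h.self_of_nhds
  have hX := inChart_totalForm (η := η) he hz hs
  have hn : ∀ X, IsNilpotentAlong f (e.symm z) (inChart e η z X) := fun X =>
    hη.nilpotent _ hp _
  have hopen : IsOpen (e.target ∩ e.symm ⁻¹' U) := e.symm.isOpen_inter_preimage hU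
  have hηs : ContDiffAt ℝ ∞ (inChart e η) z :=
    (hη.smooth e he).contDiffAt (hopen.mem_nhds ⟨hz, hp⟩)
  have hsm : ∀ X, ContDiffAt ℝ ∞ (fun w => inChart e (totalForm S η) w X) z := by
    intro X
    have e1 : (fun w => inChart e (totalForm S η) w X) =ᶠ[𝓝 z]
        fun w => hopfForm (fun w => S (e.symm w)) w X + inChart e η w X := by
      filter_upwards [hopen.mem_nhds ⟨hz, hp⟩] with w hw
      exact inChart_totalForm he hw.1 (hS.contMDiffAt hU hw.2) X
    refine ContDiffAt.congr_of_eventuallyEq ?_ e1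
    exact ContDiffAt.add (F := EndV) (contDiffAt_hopfForm ha.smooth X)
      (hηs.clm_apply contDiffAt_const)
  refine ⟨contDiffAt_planeForm (hsm _) (hsm _), ?_, ?_, ?_, ?_⟩
  · intro X
    rw [hX]
    exact (isQuaternionic_hopfForm h X).add (hn X).1
  · intro X v
    rw [hX]
    refine Submodule.add_mem _ (hopfForm_mem h X v) ?_
    rw [← hl]
    exact (hn X).2.1 v
  · intro X
    have h1 : inChart e η z X (φ z) = 0 :=
      (hn X).2.2 _ (by rw [hl]; exact self_mem_hline _)
    rw [hX, add_apply, h1, add_zero]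
    exact hopfForm_frame h X
  · exact hη.closed e he z ⟨hz, hp⟩

/-- A closed form `ω` with values in `L` such that `ω + ∇S` vanishes on `L` yields the Lagrange
multiplier `ω - 2⋆A`. -/
lemma isLagrangeMultiplierOn_of_chart {S : M → EndV} {α : OneForm M EndV}
    (H : ∀ e ∈ atlas ℂ M, ∀ z ∈ e.target, e.symm z ∈ U → ∃ φ : ℂ → V,
      line f (e.symm z) = hline (φ z) ∧
      (∀ᶠ w in 𝓝 z, SphereAt φ (fun w => S (e.symm w)) w) ∧
      WillmoreFormAt φ (fun w => S (e.symm w)) (inChart e α) z) :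
    IsLagrangeMultiplierOn f S (fun p => α p - (2 : ℝ) • starForm (hopfA S) p) U := by
  have hX : ∀ e ∈ atlas ℂ M, ∀ z ∈ e.target,
      ContDiffAt ℝ ∞ (fun w => S (e.symm w)) z → ∀ X,
      inChart e (fun p => α p - (2 : ℝ) • starForm (hopfA S) p) z X =
        inChart e α z X - hopfForm (fun w => S (e.symm w)) z X := by
    intro e he z hz hs X
    rw [← inChart_two_star_hopfA he hz (contMDiffAt_of_comp_chart_symm he hz hs)]
    rfl
  refine ⟨?_, ?_, ?_⟩
  · intro e he z hz
    obtain ⟨φ, hl, h, k⟩ := H e he z hz.1 hz.2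
    have ha := h.self_of_nhds
    refine ContDiffAt.contDiffWithinAt ?_
    have hsm : ∀ X, ContDiffAt ℝ ∞
        (fun w => inChart e (fun p => α p - (2 : ℝ) • starForm (hopfA S) p) w X) z := by
      intro X
      have e1 : (fun w => inChart e (fun p => α p - (2 : ℝ) • starForm (hopfA S) p) w X) =ᶠ[𝓝 z]
          fun w => inChart e α w X - hopfForm (fun w => S (e.symm w)) w X := by
        filter_upwards [h, e.open_target.mem_nhds hz.1] with w hw hw'
        exact hX e he w hw' hw.smooth X
      refine ContDiffAt.congr_of_eventuallyEq ?_ e1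
      exact ContDiffAt.sub (F := EndV) (k.smooth_apply X) (contDiffAt_hopfForm ha.smooth X)
    exact contDiffAt_planeForm (hsm _) (hsm _)
  · intro p hp X
    have he := chart_mem_atlas ℂ p
    have hz := mem_chart_target ℂ p
    have hs : (chartAt ℂ p).symm (chartAt ℂ p p) = p :=
      (chartAt ℂ p).left_inv (mem_chart_source ℂ p)
    generalize chartAt ℂ p = e at he hz hs
    generalize e p = z at hz hs
    subst hs
    obtain ⟨φ, hl, h, k⟩ := H e he z hz hp
    have ha := h.self_of_nhds
    obtain ⟨Z, rfl⟩ := (chartD_bijective he hz).2 X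
    rw [← inChart_apply (fun p => α p - (2 : ℝ) • starForm (hopfA S) p),
      hX e he z hz ha.smooth]
    have hq := (k.quaternionic Z).sub (isQuaternionic_hopfForm h Z)
    refine ⟨hq, ?_, ?_⟩
    · intro v
      rw [hl, sub_apply]
      exact Submodule.sub_mem _ (k.mem Z v) (hopfForm_mem h Z v)
    · intro v hv
      rw [hl] at hv
      refine hq.eq_zero_of_mem_hline ?_ hv
      rw [sub_apply, ← add_sub_add_right_eq_sub _ _ (fderiv ℝ (fun w => S (e.symm w)) z Z (φ z)),
        k.frame, hopfForm_frame h, sub_zero]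
  · have h1 : (fun p => (2 : ℝ) • starForm (hopfA S) p +
        (α p - (2 : ℝ) • starForm (hopfA S) p)) = α := by
      funext p
      exact add_sub_cancel _ _
    rw [h1]
    intro e he z hz
    obtain ⟨φ, hl, h, k⟩ := H e he z hz.1 hz.2
    exact k.closed

end Translation


/-! ### Independence of the parallel section -/

lemma SphereAt.congr {φ : ℂ → V} {S S' : ℂ → EndV} {z : ℂ} (h : SphereAt φ S z)
    (hS : S' =ᶠ[𝓝 z] S) : SphereAt φ S' z := by
  have h1 : (fun w => S' w (φ w)) =ᶠ[𝓝 z] fun w => S w (φ w) :=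
    hS.mono fun w hw => by simp only [hw]
  obtain ⟨a, b, c, d, e, m, l, r, q, i⟩ := h
  rw [← h1.fderiv_eq] at r
  rw [← hS.fderiv_eq] at q
  rw [← hS.self_of_nhds] at d e m l q
  exact ⟨a, b.congr_of_eventuallyEq hS, c, d, e, m, l, r, q, i⟩

lemma WillmoreFormAt.congr {φ : ℂ → V} {S S' : ℂ → EndV} {Ω Ω' : PlaneForm EndV} {z : ℂ}
    (h : WillmoreFormAt φ S Ω z) (hS : S' =ᶠ[𝓝 z] S) (hΩ : Ω' =ᶠ[𝓝 z] Ω) :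
    WillmoreFormAt φ S' Ω' z := by
  obtain ⟨a, b, c, d, e⟩ := h
  rw [← hΩ.fderiv_eq] at e
  rw [← hΩ.self_of_nhds] at b c d
  rw [← hS.fderiv_eq] at d
  exact ⟨a.congr_of_eventuallyEq hΩ, b, c, d, e⟩

namespace TransformAt

variable {φ : ℂ → V} {S : ℂ → EndV} {Ω : PlaneForm EndV} {ψ : ℂ → V} {c : ℍ} {z : ℂ}

lemma fderiv_ne_zero (t : TransformAt φ S Ω ψ c z) (h : SphereAt φ S z) {X : ℂ} (hX : X ≠ 0) :
    fderiv ℝ ψ z X ≠ 0 := by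
  intro h0
  rw [clm_eq_re_im (fderiv ℝ ψ z) X, t.apply_I] at h0
  have h1 := congrArg (S z) h0
  rw [map_add, map_smul, map_smul, h.sq, map_zero] at h1
  have hu := t.ne_zero
  generalize fderiv ℝ ψ z 1 = u at *
  have h2 : (X.re ^ 2 + X.im ^ 2) • u = 0 := by
    have : (X.re ^ 2 + X.im ^ 2) • u = X.re • (X.re • u + X.im • S z u) -
        X.im • (X.re • S z u + X.im • -u) := by module
    rw [this, h0, h1, smul_zero, smul_zero, sub_zero]
  have h3 := (smul_eq_zero.1 h2).resolve_right hu
  apply hX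
  apply Complex.ext
  · exact pow_eq_zero_iff (two_ne_zero) |>.1 (by nlinarith [sq_nonneg X.re, sq_nonneg X.im])
  · exact pow_eq_zero_iff (two_ne_zero) |>.1 (by nlinarith [sq_nonneg X.re, sq_nonneg X.im])

variable (h : ∀ᶠ w in 𝓝 z, SphereAt φ S w) (k : ∀ᶠ w in 𝓝 z, WillmoreFormAt φ S Ω w)
  (t : TransformAt φ S Ω ψ c z) {a : ℍ} (ha : a ≠ 0) {X : ℂ} (hX : X ≠ 0)
include h k t ha hX

lemma quotForm_eq (v : V) :
    quotForm (fderiv ℝ ψ z X <• a) (Ω z X) v = a⁻¹ * y Ω ψ z v := by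
  have hu : fderiv ℝ ψ z X <• a ≠ 0 := fun h0 =>
    ha (hmul_eq_zero (t.fderiv_ne_zero h.self_of_nhds hX) h0)
  have e : Ω z X v = (fderiv ℝ ψ z X <• a) <• (a⁻¹ * y Ω ψ z v) := by
    rw [smul_hmul, ← mul_assoc, mul_inv_cancel₀ ha, one_mul, t.form_apply h k]
  change hcoord _ (Ω z X v) = _
  rw [e, hcoord_hmul hu]

/-- The endomorphism `Y` does not depend on the section `ψ`, nor on the tangent vector at which
`ω` and `dψ` are evaluated. -/
lemma darbouxY_eq : darbouxY (ψ z <• a) (fderiv ℝ ψ z X <• a) (Ω z X) = pot Ω ψ z := by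
  ext1 v
  rw [darbouxY_apply, t.quotForm_eq h k ha hX, smul_hmul, ← mul_assoc, mul_inv_cancel₀ ha, one_mul]
  rfl

/-- The endomorphism `S♯` does not depend on the section `ψ`, nor on the tangent vector at which
`ω` and `dψ` are evaluated. -/
lemma darbouxSphere_eq :
    darbouxSphere (ψ z <• a) (fderiv ℝ ψ z X <• a) (S z) (Ω z X) = sphere S Ω ψ z := by
  have hz := h.self_of_nhds
  have kz := k.self_of_nhds
  have hu : fderiv ℝ ψ z X <• a ≠ 0 := fun h0 =>
    ha (hmul_eq_zero (t.fderiv_ne_zero hz hX) h0)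
  have hl : hline (fderiv ℝ ψ z X <• a) = hline (φ z) :=
    hline_eq_of_mem (Submodule.smul_mem _ _ (t.fderiv_mem hz X)) hu
  have hp : ψ z <• a ∉ hline (fderiv ℝ ψ z X <• a) := by
    rw [hl]
    exact fun hm => ha (hmul_left_mem_iff t.not_mem hm)
  have hq : IsQuaternionic (darbouxSphere (ψ z <• a) (fderiv ℝ ψ z X <• a) (S z) (Ω z X)) :=
    isQuaternionic_darbouxSphere hz.quaternionic (kz.quaternionic X)
  refine hq.ext_basis (isQuaternionic_darbouxSphere hz.quaternionic (kz.quaternionic 1))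
    hu hp ?_ ?_
  · rw [darbouxSphere_of_mem hu (self_mem_hline _), t.quotForm_eq h k ha hX, smul_hmul,
      ← mul_assoc, mul_inv_cancel₀ ha, one_mul]
    exact (t.sphere_of_mem (Submodule.smul_mem _ _ (t.fderiv_mem hz X))).symm
  · have hb : eigenQuat (fderiv ℝ ψ z X <• a) (S z) = a⁻¹ * (b S ψ z * a) := by
      have e : S z (fderiv ℝ ψ z X <• a) =
          (fderiv ℝ ψ z X <• a) <• (a⁻¹ * (b S ψ z * a)) := by
        rw [smul_hmul, ← mul_assoc, mul_inv_cancel₀ ha, one_mul, hz.quaternionic.hmul,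
          t.apply_fderiv hz, smul_hmul]
      rw [eigenQuat, e, hcoord_hmul hu]
    rw [darbouxSphere_self hp, hb, smul_hmul, ← mul_assoc, mul_inv_cancel₀ ha, one_mul]
    have hq1 : IsQuaternionic (sphere S Ω ψ z) :=
      isQuaternionic_darbouxSphere hz.quaternionic (kz.quaternionic 1)
    change _ = sphere S Ω ψ z (ψ z <• a)
    rw [hq1.hmul, t.sphere_self, smul_hmul]

end TransformAt

/-! ### Parallel sections of `∇^μ` -/

/-- The coefficient `(μ - 1)² / 4μ` of `Sωψ` in the equation for a `∇^μ`-parallel section. -/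
def parCoefA (μ : ℂ) : ℂ := (μ - 1 + (μ⁻¹ - 1)) / 4

/-- The coefficient `i (μ - μ⁻¹) / 4` of `ωψ` in the equation for a `∇^μ`-parallel section. -/
def parCoefB (μ : ℂ) : ℂ := Complex.I * (μ - μ⁻¹) / 4

lemma parCoef_sq {μ : ℂ} (hμ : μ ≠ 0) :
    parCoefA μ ^ 2 + parCoefB μ ^ 2 = -parCoefA μ := by
  unfold parCoefA parCoefB
  field_simp
  ring_nf
  simp only [Complex.I_sq]
  ring

section Manifold

variable {M : Type*} [TopologicalSpace M] [ChartedSpace ℂ M]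
  {f g : M → HP1} {S : M → EndV} {η : OneForm M EndV} {μ : ℂ}

/-- `ψ` is, near `p`, a smooth `∇^μ`-parallel section which spans the line bundle of `g` and whose
projection to `V/L` has no zeros. -/
def IsParallelFrameNear (f : M → HP1) (S : M → EndV) (η : OneForm M EndV) (μ : ℂ) (g : M → HP1)
    (p : M) (ψ : M → V) : Prop :=
  ∀ᶠ q in 𝓝 p, ContMDiffAt 𝓘(ℝ, ℂ) 𝓘(ℝ, V) ∞ ψ q ∧ (∀ X : Tan q, nablaMu S η μ ψ q X = 0) ∧
    ψ q ∉ line f q ∧ line g q = Submodule.span ℍᵐᵒᵖ {ψ q}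

lemma IsParallelFrameNear.isSectionNear {p : M} {ψ : M → V}
    (h : IsParallelFrameNear f S η μ g p ψ) : IsSectionNear g p ψ :=
  h.mono fun q hq => ⟨hq.1, by rw [hq.2.2.2]; exact self_mem_hline _⟩

lemma IsParallelFrameNear.ne_zero {p : M} {ψ : M → V}
    (h : IsParallelFrameNear f S η μ g p ψ) : ψ p ≠ 0 := by
  intro h0
  apply h.self_of_nhds.2.2.1
  rw [h0]
  exact Submodule.zero_mem _

/-- The equation `∇^μ ψ = 0` in terms of `ω = 2⋆A + η`, for which `A_∘ = -½ Sω`. -/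
lemma diff_eq_of_nablaMu {ψ : M → V} {p : M} {X : Tan p}
    (hsq : ∀ v, S p (S p v) = -v)
    (hΩ : ∀ v, totalForm S η p (tanJ p X) v = S p (totalForm S η p X v))
    (h : nablaMu S η μ ψ p X = 0) :
    diff ψ p X = S p (totalForm S η p X (ψ p)) <• (parCoefA μ : ℍ) +
      totalForm S η p X (ψ p) <• (parCoefB μ : ℍ) := by
  have hA : ∀ v, hopfA₀ S η p X v = -((1 / 2 : ℝ) • S p (totalForm S η p X v)) := by
    intro v
    rw [← hΩ]
    have hJ : tanJ p (tanJ p X) = -X := by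
      have hI : ∀ x : ℂ, Complex.I * (Complex.I * x) = -x := fun x => by
        rw [← mul_assoc, Complex.I_mul_I, neg_one_mul]
      exact hI X
    change (hopfA S p X - (1 / 2 : ℝ) • η p (tanJ p X)) v =
      -((1 / 2 : ℝ) • ((2 : ℝ) • hopfA S p (tanJ p (tanJ p X)) + η p (tanJ p X)) v)
    rw [hJ, map_neg]
    simp only [sub_apply, smul_apply, add_apply, neg_apply]
    module
  have hSA : ∀ v, S p (hopfA₀ S η p X v) = (1 / 2 : ℝ) • totalForm S η p X v := by
    intro v
    rw [hA, map_neg, map_smul, hsq, smul_neg, neg_neg]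
  have h10 : hopfA10 S η p X (ψ p) = (1 / 2 : ℝ) •
      (hopfA₀ S η p X (ψ p) - S p (hopfA₀ S η p X (ψ p)) <• ((Complex.I : ℂ) : ℍ)) := rfl
  have h01 : hopfA01 S η p X (ψ p) = (1 / 2 : ℝ) •
      (hopfA₀ S η p X (ψ p) + S p (hopfA₀ S η p X (ψ p)) <• ((Complex.I : ℂ) : ℍ)) := rfl
  unfold nablaMu cmul at h
  rw [h10, h01, hSA, hA, rightMul_apply, rightMul_apply] at h
  -- It remains to collect the complex coefficients, which act from the right.
  generalize totalForm S η p X (ψ p) = x at h ⊢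
  have hc : ∀ (v : V) (r : ℝ) (q : ℂ), (r • v) <• (q : ℍ) = v <• ((r * q : ℂ) : ℍ) := by
    intro v r q
    rw [Quaternion.coeComplex_mul, Quaternion.coeComplex_coe, Quaternion.coe_mul_eq_smul,
      MulOpposite.op_smul, smul_assoc, smul_comm]
  have hn : ∀ (v : V) (q : ℂ), -(v <• (q : ℍ)) = v <• ((-q : ℂ) : ℍ) := by
    intro v q
    rw [← hmul_neg]
    congr 2
    ext <;> simp
  have ha : ∀ (v : V) (q r : ℂ), v <• (q : ℍ) + v <• (r : ℍ) = v <• ((q + r : ℂ) : ℍ) := by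
    intro v q r
    rw [Quaternion.coeComplex_add, hmul_add]
  have hm : ∀ (v : V) (q r : ℂ), (v <• (q : ℍ)) <• (r : ℍ) = v <• ((q * r : ℂ) : ℍ) := by
    intro v q r
    rw [smul_hmul, Quaternion.coeComplex_mul]
  generalize S p x = s at h ⊢
  have e1 : ((1 / 2 : ℝ) • (-((1 / 2 : ℝ) • s) - ((1 / 2 : ℝ) • x) <• ((Complex.I : ℂ) : ℍ))) <•
      ((μ - 1 : ℂ) : ℍ) = -(s <• (((μ - 1) / 4 : ℂ) : ℍ)) -
        x <• ((Complex.I * (μ - 1) / 4 : ℂ) : ℍ) := by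
    rw [hc, smul_sub, smul_neg, hc, hc, hm]
    refine congrArg₂ _ (congrArg _ (congrArg (fun q : ℂ => s <• (q : ℍ)) ?_))
      (congrArg (fun q : ℂ => x <• (q : ℍ)) ?_)
    · push_cast
      ring
    · push_cast
      ring
  have e2 : ((1 / 2 : ℝ) • (-((1 / 2 : ℝ) • s) + ((1 / 2 : ℝ) • x) <• ((Complex.I : ℂ) : ℍ))) <•
      ((μ⁻¹ - 1 : ℂ) : ℍ) = -(s <• (((μ⁻¹ - 1) / 4 : ℂ) : ℍ)) +
        x <• ((Complex.I * (μ⁻¹ - 1) / 4 : ℂ) : ℍ) := by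
    rw [hc, smul_add, smul_neg, hc, hc, hm]
    refine congrArg₂ _ (congrArg _ (congrArg (fun q : ℂ => s <• (q : ℍ)) ?_))
      (congrArg (fun q : ℂ => x <• (q : ℍ)) ?_)
    · push_cast
      ring
    · push_cast
      ring
  rw [e1, e2] at h
  have e3 : parCoefA μ = (μ - 1) / 4 + (μ⁻¹ - 1) / 4 := by
    unfold parCoefA
    ring
  have e4 : parCoefB μ = Complex.I * (μ - 1) / 4 + -(Complex.I * (μ⁻¹ - 1) / 4) := by
    unfold parCoefB
    ring
  rw [e3, e4, ← ha, ← ha, ← hn, ← sub_eq_zero, ← h]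
  abel

variable [IsManifold 𝓘(ℂ) ω M] {e : OpenPartialHomeomorph M ℂ} {z : ℂ}

/-- Near each point of a chart, the data of a constrained Willmore surface have coordinate
expressions with respect to a frame `φ` of the line bundle. -/
lemma exists_chart_data (hf : IsConformalImmersionOn f univ)
    (hS : IsMeanCurvatureSphereOn f S univ) (hη : IsLagrangeMultiplierOn f S η univ)
    (he : e ∈ atlas ℂ M) (hz : z ∈ e.target) :
    ∃ φ : ℂ → V, (∀ᶠ w in 𝓝 z, SphereAt φ (fun w => S (e.symm w)) w) ∧
      (∀ᶠ w in 𝓝 z, WillmoreFormAt φ (fun w => S (e.symm w)) (inChart e (totalForm S η)) w) ∧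
      ∀ᶠ w in 𝓝 z, line f (e.symm w) = hline (φ w) := by
  obtain ⟨φ, hφ, h0⟩ := hf.smooth (e.symm z) (mem_univ _)
  have h := hS.eventually_sphereAt isOpen_univ hf.immersed he hz (mem_univ _) hφ h0
  have hl := eventually_chart_symm hz (hφ.eventually_frame h0)
  refine ⟨fun w => φ (e.symm w), h, ?_, hl.mono fun w hw => hw.2.2⟩
  filter_upwards [h.eventually_nhds, hl] with w hw hlw
  exact hη.willmoreFormAt hS isOpen_univ he hlw.1 (mem_univ _) hlw.2.2 hw

section Parallel

variable {φ : ℂ → V} (he : e ∈ atlas ℂ M) (hz : z ∈ e.target)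
  (h : ∀ᶠ w in 𝓝 z, SphereAt φ (fun w => S (e.symm w)) w)
  (k : ∀ᶠ w in 𝓝 z, WillmoreFormAt φ (fun w => S (e.symm w)) (inChart e (totalForm S η)) w)
  (hl : ∀ᶠ w in 𝓝 z, line f (e.symm w) = hline (φ w))
  {ψ : M → V} (hψ : IsParallelFrameNear f S η μ g (e.symm z) ψ)
include he hz h k hψ

/-- A parallel section in a chart. -/
lemma IsParallelFrameNear.fderiv_eq (X : ℂ) :
    fderiv ℝ (fun w => ψ (e.symm w)) z X =
      S (e.symm z) (inChart e (totalForm S η) z X (ψ (e.symm z))) <• (parCoefA μ : ℍ) +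
        inChart e (totalForm S η) z X (ψ (e.symm z)) <• (parCoefB μ : ℍ) := by
  have hp := hψ.self_of_nhds
  have hz' := h.self_of_nhds
  rw [fderiv_comp_chart_symm he hz hp.1]
  refine diff_eq_of_nablaMu hz'.sq ?_ (hp.2.1 _)
  intro v
  have hI := WillmoreFormAt.apply_I h k v
  rw [← chartD_I he hz, ← inChart_apply, ← inChart_apply,
    clm_eq_re_im (inChart e (totalForm S η) z) (Complex.I * X),
    clm_eq_re_im (inChart e (totalForm S η) z) X]
  simp only [add_apply, smul_apply, map_add, map_smul, Complex.I_mul_re, Complex.I_mul_im, hI,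
    hz'.sq]
  module

lemma IsParallelFrameNear.fderiv_mem (X : ℂ) :
    fderiv ℝ (fun w => ψ (e.symm w)) z X ∈ hline (φ z) := by
  rw [hψ.fderiv_eq he hz h k]
  have hm := k.self_of_nhds.mem X (ψ (e.symm z))
  exact Submodule.add_mem _ (Submodule.smul_mem _ _ (h.self_of_nhds.map_mem hm))
    (Submodule.smul_mem _ _ hm)

include hl

lemma IsParallelFrameNear.transformAt (hμ : μ ≠ 0)
    (h0 : fderiv ℝ (fun w => ψ (e.symm w)) z 1 ≠ 0) :
    TransformAt φ (fun w => S (e.symm w)) (inChart e (totalForm S η)) (fun w => ψ (e.symm w))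
      ((parCoefB μ / parCoefA μ : ℂ) : ℍ) z := by
  have hp := hψ.self_of_nhds
  refine TransformAt.of_parallel h.self_of_nhds (contDiffAt_comp_chart_symm he hz hp.1) ?_
    k.self_of_nhds (WillmoreFormAt.apply_I h k) (parCoef_sq hμ)
    (hψ.fderiv_eq he hz h k) h0
  rw [← hl.self_of_nhds]
  exact hp.2.2.1

lemma IsParallelFrameNear.eventually_transformAt (hμ : μ ≠ 0)
    (h0 : fderiv ℝ (fun w => ψ (e.symm w)) z 1 ≠ 0) :
    ∀ᶠ w in 𝓝 z, TransformAt φ (fun w => S (e.symm w)) (inChart e (totalForm S η))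
      (fun w => ψ (e.symm w)) ((parCoefB μ / parCoefA μ : ℂ) : ℍ) w := by
  have hs : ContDiffAt ℝ ∞ (fun w => ψ (e.symm w)) z :=
    contDiffAt_comp_chart_symm he hz hψ.self_of_nhds.1
  have hc := (contDiffAt_fderiv_apply hs 1).continuousAt.eventually_ne h0
  filter_upwards [h.eventually_nhds, k.eventually_nhds, hl.eventually_nhds,
    eventually_chart_symm hz (eventually_eventually_nhds.2 hψ), hc] with w h1 h2 h3 h4 h5
  exact IsParallelFrameNear.transformAt he h4.1 h1 h2 h3 h4.2 hμ h5

/-- The Darboux transform is immersed exactly where `dψ ≠ 0`. -/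
lemma IsParallelFrameNear.isImmersedAt_iff (hμ : μ ≠ 0) :
    IsImmersedAt g (e.symm z) ↔ fderiv ℝ (fun w => ψ (e.symm w)) z 1 ≠ 0 := by
  have hs := hψ.isSectionNear
  constructor
  · intro hi h0
    apply fderiv_frame_notMem he hz hs hψ.ne_zero hi
    rw [h0]
    exact Submodule.zero_mem _
  · intro h0 X hX
    obtain ⟨Z, rfl⟩ := (chartD_bijective he hz).2 X
    have t := hψ.transformAt he hz h k hl hμ h0
    have h1 := hX ψ hs
    rw [← fderiv_comp_chart_symm he hz hψ.self_of_nhds.1, hψ.self_of_nhds.2.2.2] at h1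
    have h2 := t.fderiv_mem h.self_of_nhds Z
    have h3 : fderiv ℝ (fun w => ψ (e.symm w)) z Z = 0 := by
      obtain ⟨a, ha⟩ := mem_hline.1 h1
      rw [ha] at h2
      rw [ha, hmul_left_mem_iff t.not_mem h2, hmul_zero]
    have h4 : Z = 0 := by
      by_contra hZ
      exact t.fderiv_ne_zero h.self_of_nhds hZ h3
    rw [h4]
    exact map_zero (mfderiv 𝓘(ℝ, ℂ) 𝓘(ℝ, ℂ) e.symm z)

end Parallel

/-! ### The Darboux transform on the surface -/

/-- The tangent vector `1` in the preferred chart. -/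
def tanOne (p : M) : Tan p := (1 : ℂ)

/-- The mean curvature sphere congruence of the Darboux transform, computed from a choice of
parallel sections `ψ p` near `p`. -/
def globalSphere (S : M → EndV) (η : OneForm M EndV) (ψ : M → M → V) (p : M) : EndV :=
  darbouxSphere (ψ p p) (diff (ψ p) p (tanOne p)) (S p) (totalForm S η p (tanOne p))

/-- The endomorphism field `Y`, computed from a choice of parallel sections `ψ p` near `p`. -/
def globalPot (S : M → EndV) (η : OneForm M EndV) (ψ : M → M → V) (p : M) : EndV :=
  darbouxY (ψ p p) (diff (ψ p) p (tanOne p)) (totalForm S η p (tanOne p))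

/-- The fields `S♯` and `Y` do not depend on the choice of parallel sections. -/
lemma global_eq {φ : ℂ → V} {Ψ : M → M → V}
    (hΨ : ∀ p, IsParallelFrameNear f S η μ g p (Ψ p)) (hμ : μ ≠ 0)
    (he : e ∈ atlas ℂ M) (hz : z ∈ e.target)
    (h : ∀ᶠ w in 𝓝 z, SphereAt φ (fun w => S (e.symm w)) w)
    (k : ∀ᶠ w in 𝓝 z, WillmoreFormAt φ (fun w => S (e.symm w)) (inChart e (totalForm S η)) w)
    (hl : ∀ᶠ w in 𝓝 z, line f (e.symm w) = hline (φ w))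
    {ψ : M → V} (hψ : IsParallelFrameNear f S η μ g (e.symm z) ψ)
    (h0 : fderiv ℝ (fun w => ψ (e.symm w)) z 1 ≠ 0) :
    globalSphere S η Ψ (e.symm z) = TransformAt.sphere (fun w => S (e.symm w))
      (inChart e (totalForm S η)) (fun w => ψ (e.symm w)) z ∧
    globalPot S η Ψ (e.symm z) =
      TransformAt.pot (inChart e (totalForm S η)) (fun w => ψ (e.symm w)) z := by
  have t := hψ.transformAt he hz h k hl hμ h0
  have hψ' := hΨ (e.symm z)
  obtain ⟨X, hX⟩ := (chartD_bijective he hz).2 (tanOne (e.symm z))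
  have hX0 : X ≠ 0 := by
    rintro rfl
    have h1 : chartD e z 0 = 0 := map_zero (mfderiv 𝓘(ℝ, ℂ) 𝓘(ℝ, ℂ) e.symm z)
    have h2 : (1 : ℂ) = 0 := hX.symm.trans h1
    exact one_ne_zero h2
  have hm : Ψ (e.symm z) (e.symm z) ∈ hline (ψ (e.symm z)) := by
    rw [hline, ← hψ.self_of_nhds.2.2.2]
    exact hψ'.isSectionNear.self_of_nhds.2
  obtain ⟨a, ha⟩ := mem_hline.1 hm
  have ha0 : a ≠ 0 := by
    rintro rfl
    rw [hmul_zero] at ha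
    exact hψ'.ne_zero ha
  -- If `ψ' = ψ a`, then `dψ' - dψ a` lies in `L♯ ∩ L = 0`, although `a` is not constant a priori.
  have hd : fderiv ℝ (fun w => Ψ (e.symm z) (e.symm w)) z X =
      fderiv ℝ (fun w => ψ (e.symm w)) z X <• a := by
    have h1 := hψ.isSectionNear.fderiv_sub_mem he hz hψ.ne_zero hψ'.isSectionNear ha X
    have h2 := Submodule.sub_mem _ (hψ'.fderiv_mem he hz h k X)
      (Submodule.smul_mem _ (MulOpposite.op a) (hψ.fderiv_mem he hz h k X))
    obtain ⟨s, hs⟩ := mem_hline.1 h1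
    rw [hs] at h2
    rw [← sub_eq_zero, hs, hmul_left_mem_iff t.not_mem h2, hmul_zero]
  unfold globalSphere globalPot
  rw [← hX, ← fderiv_comp_chart_symm he hz hψ'.self_of_nhds.1, ← inChart_apply, hd, ha]
  exact ⟨t.darbouxSphere_eq h k ha0 hX0, t.darbouxY_eq h k ha0 hX0⟩

/-- The closed form `ω - dY` of the Darboux transform. -/
def globalForm (S : M → EndV) (η : OneForm M EndV) (ψ : M → M → V) : OneForm M EndV :=
  fun p => totalForm S η p - diff (globalPot S η ψ) p

/-- The Darboux transform in a chart, near a point at which it is immersed. -/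
lemma darboux_chart (hf : IsConformalImmersionOn f univ)
    (hS : IsMeanCurvatureSphereOn f S univ) (hη : IsLagrangeMultiplierOn f S η univ)
    {Ψ : M → M → V} (hΨ : ∀ p, IsParallelFrameNear f S η μ g p (Ψ p)) (hμ : μ ≠ 0)
    (he : e ∈ atlas ℂ M) (hz : z ∈ e.target) (hi : IsImmersedAt g (e.symm z)) :
    ∃ ψ : M → V, IsSectionNear g (e.symm z) ψ ∧ ψ (e.symm z) ≠ 0 ∧
      (∀ᶠ w in 𝓝 z, SphereAt (fun w => ψ (e.symm w)) (fun w => globalSphere S η Ψ (e.symm w)) w) ∧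
      (∀ᶠ w in 𝓝 z, WillmoreFormAt (fun w => ψ (e.symm w))
        (fun w => globalSphere S η Ψ (e.symm w)) (inChart e (globalForm S η Ψ)) w) ∧
      (η = 0 → ∀ᶠ w in 𝓝 z, ∀ X, inChart e (globalForm S η Ψ) w X =
        hopfForm (fun w => globalSphere S η Ψ (e.symm w)) w X) := by
  obtain ⟨φ, h, k, hl⟩ := exists_chart_data hf hS hη he hz
  have hψ := hΨ (e.symm z)
  set ψ := Ψ (e.symm z)
  have h0 := (hψ.isImmersedAt_iff he hz h k hl hμ).1 hi
  have t := hψ.eventually_transformAt he hz h k hl hμ h0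
  have hg : ∀ᶠ w in 𝓝 z, w ∈ e.target ∧ globalSphere S η Ψ (e.symm w) =
      TransformAt.sphere (fun w => S (e.symm w)) (inChart e (totalForm S η))
        (fun w => ψ (e.symm w)) w ∧ globalPot S η Ψ (e.symm w) =
      TransformAt.pot (inChart e (totalForm S η)) (fun w => ψ (e.symm w)) w := by
    filter_upwards [h.eventually_nhds, k.eventually_nhds, hl.eventually_nhds, t,
      eventually_chart_symm hz (eventually_eventually_nhds.2 hψ)] with w h1 h2 h3 h4 h5
    exact ⟨h5.1, global_eq hΨ hμ he h5.1 h1 h2 h3 h5.2 h4.ne_zero⟩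
  have hgF : ∀ᶠ w in 𝓝 z, inChart e (globalForm S η Ψ) w =
      TransformAt.sharpForm (inChart e (totalForm S η)) (fun w => ψ (e.symm w)) w := by
    filter_upwards [hg.eventually_nhds, k, t] with w h1 h2 h3
    have e1 : (fun w => globalPot S η Ψ (e.symm w)) =ᶠ[𝓝 w]
        TransformAt.pot (inChart e (totalForm S η)) (fun w => ψ (e.symm w)) :=
      h1.mono fun u hu => hu.2.2
    have e2 : ContMDiffAt 𝓘(ℝ, ℂ) 𝓘(ℝ, EndV) ∞ (globalPot S η Ψ) (e.symm w) :=
      contMDiffAt_of_comp_chart_symm he h1.self_of_nhds.1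
        ((h3.smooth_pot h2).congr_of_eventuallyEq e1)
    ext1 X
    change inChart e (totalForm S η) w X - inChart e (diff (globalPot S η Ψ)) w X =
      inChart e (totalForm S η) w X - fderiv ℝ _ w X
    rw [inChart_diff he h1.self_of_nhds.1 e2, e1.fderiv_eq]
  have hsph : ∀ᶠ w in 𝓝 z, SphereAt (fun w => ψ (e.symm w))
      (fun w => globalSphere S η Ψ (e.symm w)) w := by
    filter_upwards [h.eventually_nhds, k.eventually_nhds, t.eventually_nhds, hg.eventually_nhds]
      with w h1 h2 h3 h4
    exact (TransformAt.sphereAt h1 h2 h3).congr (h4.mono fun u hu => hu.2.1)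
  have hwil : ∀ᶠ w in 𝓝 z, WillmoreFormAt (fun w => ψ (e.symm w))
      (fun w => globalSphere S η Ψ (e.symm w)) (inChart e (globalForm S η Ψ)) w := by
    filter_upwards [h.eventually_nhds, k.eventually_nhds, t.eventually_nhds, hg.eventually_nhds,
      hgF.eventually_nhds] with w h1 h2 h3 h4 h5
    exact (TransformAt.willmoreFormAt h1 h2 h3).congr (h4.mono fun u hu => hu.2.1) h5
  refine ⟨ψ, hψ.isSectionNear, hψ.ne_zero, hsph, hwil, ?_⟩
  rintro rfl
  -- For `η = 0` the form `ω = 2⋆A` anticommutes with `S`.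
  have hanti : ∀ᶠ w in 𝓝 z, ∀ v, inChart e (totalForm S 0) w 1 (S (e.symm w) v) =
      -S (e.symm w) (inChart e (totalForm S 0) w 1 v) := by
    filter_upwards [h.eventually_nhds, hg] with w h1 h2 v
    have hs := contMDiffAt_of_comp_chart_symm he h2.1 h1.self_of_nhds.smooth
    have ha := h1.self_of_nhds
    have hA := SphereAt.anticomm h1
    have e1 : inChart e (totalForm S 0) w 1 = hopfForm (fun w => S (e.symm w)) w 1 := by
      rw [inChart_totalForm he h2.1 hs]
      exact add_zero _
    rw [e1, hopfForm_one]
    simp only [smul_apply, sub_apply, ContinuousLinearMap.comp_apply, map_smul, map_sub, ha.sq]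
    have e2 : S (e.symm w) (fderiv ℝ (fun w => S (e.symm w)) w Complex.I (S (e.symm w) v)) =
        fderiv ℝ (fun w => S (e.symm w)) w Complex.I v := by
      rw [hA, ha.sq, map_neg, neg_neg]
    rw [e2, ← neg_neg (fderiv ℝ (fun w => S (e.symm w)) w 1 (S (e.symm w) v)), ← hA]
    module
  filter_upwards [h.eventually_nhds, k.eventually_nhds, t.eventually_nhds, hg, hgF,
    hanti.eventually_nhds, hsph.eventually_nhds, hwil.eventually_nhds]
    with w h1 h2 h3 h4 h5 h6 h7 h8 X
  have e1 := TransformAt.sharpForm_anticomm h1 h2 h3 h6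
  rw [← h5, ← h4.2.1] at e1
  obtain ⟨e2, e3⟩ := WillmoreFormAt.eq_hopf h7 h8 e1
  ext1 v
  rw [hopfForm_eq_re_im, hopfForm_one, hopfForm_I, ← e2, ← e3,
    clm_eq_re_im (inChart e (globalForm S 0 Ψ) w) X]
  rfl

/-- The set of immersed points of a Darboux transform is open. -/
lemma isOpen_immersedSet_of_darboux (hf : IsConformalImmersionOn f univ)
    (hS : IsMeanCurvatureSphereOn f S univ) (hη : IsLagrangeMultiplierOn f S η univ)
    {Ψ : M → M → V} (hΨ : ∀ p, IsParallelFrameNear f S η μ g p (Ψ p)) (hμ : μ ≠ 0) :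
    IsOpen (immersedSet g) := by
  rw [isOpen_iff_mem_nhds]
  intro p hp
  have he := chart_mem_atlas ℂ p
  have hz := mem_chart_target ℂ p
  have hp' := mem_chart_source ℂ p
  have hs : (chartAt ℂ p).symm (chartAt ℂ p p) = p := (chartAt ℂ p).left_inv hp'
  generalize chartAt ℂ p = e at he hz hs hp'
  have hc := e.continuousAt hp'
  obtain ⟨φ, h, k, hl⟩ := exists_chart_data hf hS hη he hz
  have hψ := hΨ p
  have hψ2 : IsParallelFrameNear f S η μ g (e.symm (e p)) (Ψ p) := by
    rw [hs]
    exact hψ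
  have h0 := (hψ2.isImmersedAt_iff he hz h k hl hμ).1 (by rw [hs]; exact hp)
  have t := hψ2.eventually_transformAt he hz h k hl hμ h0
  filter_upwards [e.open_source.mem_nhds hp', hc.eventually h.eventually_nhds,
    hc.eventually k.eventually_nhds, hc.eventually hl.eventually_nhds, hc.eventually t,
    eventually_eventually_nhds.2 hψ] with q hq h1 h2 h3 h4 h5
  have hqs : e.symm (e q) = q := e.left_inv hq
  have h5' : IsParallelFrameNear f S η μ g (e.symm (e q)) (Ψ p) := by
    rw [hqs]
    exact h5
  have h6 := (h5'.isImmersedAt_iff he (e.map_source hq) h1 h2 h3 hμ).2 h4.ne_zero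
  rw [hqs] at h6
  exact h6

/-- The Darboux transform of a constrained Willmore surface, together with its mean curvature
sphere congruence and its Lagrange multiplier. -/
lemma darboux_isConstrainedWillmoreOn (hf : IsConformalImmersionOn f univ)
    (hS : IsMeanCurvatureSphereOn f S univ) (hη : IsLagrangeMultiplierOn f S η univ)
    {Ψ : M → M → V} (hΨ : ∀ p, IsParallelFrameNear f S η μ g p (Ψ p)) (hμ : μ ≠ 0) :
    IsConformalImmersionOn g (immersedSet g) ∧
      IsMeanCurvatureSphereOn g (globalSphere S η Ψ) (immersedSet g) ∧
      IsLagrangeMultiplierOn g (globalSphere S η Ψ)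
        (fun p => globalForm S η Ψ p - (2 : ℝ) • starForm (hopfA (globalSphere S η Ψ)) p)
        (immersedSet g) := by
  have hU := isOpen_immersedSet_of_darboux hf hS hη hΨ hμ
  have hT : IsMeanCurvatureSphereOn g (globalSphere S η Ψ) (immersedSet g) := by
    refine isMeanCurvatureSphereOn_of_chart fun p hp => ?_
    have hs : (chartAt ℂ p).symm (chartAt ℂ p p) = p :=
      (chartAt ℂ p).left_inv (mem_chart_source ℂ p)
    obtain ⟨ψ, h1, -, h3, -⟩ := darboux_chart hf hS hη hΨ hμ (chart_mem_atlas ℂ p)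
      (mem_chart_target ℂ p) (by rw [hs]; exact hp)
    rw [hs] at h1
    exact ⟨_, chart_mem_atlas ℂ p, _, mem_chart_target ℂ p, hs, ψ, h1, h3⟩
  refine ⟨hT.isConformalImmersionOn hU (fun p _ => ⟨Ψ p, (hΨ p).isSectionNear, (hΨ p).ne_zero⟩)
    fun p hp => hp, hT, isLagrangeMultiplierOn_of_chart fun e he z hz hp => ?_⟩
  obtain ⟨ψ, h1, h2, h3, h4, -⟩ := darboux_chart hf hS hη hΨ hμ he hz hp
  exact ⟨fun w => ψ (e.symm w), (h1.eventually_frame h2).self_of_nhds.2, h3, h4.self_of_nhds⟩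

/-- For `η = 0` the Darboux transform is again Willmore. -/
lemma darboux_isClosedFormOn (hf : IsConformalImmersionOn f univ)
    (hS : IsMeanCurvatureSphereOn f S univ) (hη : IsLagrangeMultiplierOn f S 0 univ)
    {Ψ : M → M → V} (hΨ : ∀ p, IsParallelFrameNear f S 0 μ g p (Ψ p)) (hμ : μ ≠ 0) :
    IsClosedFormOn (starForm (hopfA (globalSphere S 0 Ψ))) (immersedSet g) := by
  rw [← isClosedFormOn_real_smul_iff (two_ne_zero (α := ℝ))]
  intro e he z hz
  obtain ⟨ψ, -, -, h3, h4, h5⟩ := darboux_chart hf hS hη hΨ hμ he hz.1 hz.2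
  have e1 : inChart e (fun p => (2 : ℝ) • starForm (hopfA (globalSphere S 0 Ψ)) p) =ᶠ[𝓝 z]
      inChart e (globalForm S 0 Ψ) := by
    filter_upwards [h3, h5 rfl, e.open_target.mem_nhds hz.1] with w h6 h7 h8
    ext1 X
    rw [inChart_two_star_hopfA he h8 (contMDiffAt_of_comp_chart_symm he h8 h6.smooth), h7]
  rw [e1.fderiv_eq]
  exact h4.self_of_nhds.closed

/-- The mean curvature sphere congruence of a conformal immersion is unique. -/
lemma IsMeanCurvatureSphereOn.unique {S' : M → EndV} (hf : IsConformalImmersionOn f univ)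
    (hS : IsMeanCurvatureSphereOn f S univ) (hS' : IsMeanCurvatureSphereOn f S' univ) :
    S = S' := by
  funext p
  have hs : (chartAt ℂ p).symm (chartAt ℂ p p) = p :=
    (chartAt ℂ p).left_inv (mem_chart_source ℂ p)
  obtain ⟨φ, hφ, h0⟩ := hf.smooth p (mem_univ _)
  rw [← hs] at hφ h0
  have h := SphereAt.unique
    (hS.eventually_sphereAt isOpen_univ hf.immersed (chart_mem_atlas ℂ p) (mem_chart_target ℂ p)
      (mem_univ _) hφ h0)
    (hS'.eventually_sphereAt isOpen_univ hf.immersed (chart_mem_atlas ℂ p)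
      (mem_chart_target ℂ p) (mem_univ _) hφ h0)
  simpa only [hs] using h

omit [IsManifold 𝓘(ℂ) ω M] in
lemma isLagrangeMultiplierOn_zero {U : Set M} (h : IsClosedFormOn (starForm (hopfA S)) U) :
    IsLagrangeMultiplierOn f S 0 U := by
  refine ⟨fun e _ => ?_, fun p _ X => ⟨?_, ?_, ?_⟩, ?_⟩
  · have h0 : inChart e (0 : OneForm M EndV) = fun _ => 0 := by
      funext w
      exact ContinuousLinearMap.zero_comp _
    rw [h0]
    exact contDiffOn_const
  · intro v a
    change (0 : V) = rightMul a 0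
    rw [map_zero]
  · intro v
    exact Submodule.zero_mem _
  · intro v _
    rfl
  · have h1 : (fun p => (2 : ℝ) • starForm (hopfA S) p + (0 : OneForm M EndV) p) =
        fun p => (2 : ℝ) • starForm (hopfA S) p := by
      funext p
      exact add_zero _
    rw [h1, isClosedFormOn_real_smul_iff two_ne_zero]
    exact h

end Manifold

end QuaternionicSurface

end

theorem mainTheorem9 {M : Type*} [TopologicalSpace M] [ChartedSpace ℂ M] [IsManifold 𝓘(ℂ) ω M]
    (f : M → QuaternionicSurface.HP1) (S : M → QuaternionicSurface.EndV)
    (hf : QuaternionicSurface.IsConformalImmersionOn f univ)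
    (hS : QuaternionicSurface.IsMeanCurvatureSphereOn f S univ) :
    (∀ η : QuaternionicSurface.OneForm M QuaternionicSurface.EndV,
      QuaternionicSurface.IsLagrangeMultiplierOn f S η univ →
      ∀ g : M → QuaternionicSurface.HP1,
        QuaternionicSurface.IsNablaMuDarbouxTransform f S η g →
        IsOpen (QuaternionicSurface.immersedSet g) ∧
          QuaternionicSurface.IsConstrainedWillmoreOn g (QuaternionicSurface.immersedSet g)) ∧
    (QuaternionicSurface.IsWillmoreOn f univ →
      ∀ g : M → QuaternionicSurface.HP1,
        QuaternionicSurface.IsNablaMuDarbouxTransform f S 0 g →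
        IsOpen (QuaternionicSurface.immersedSet g) ∧
          QuaternionicSurface.IsWillmoreOn g (QuaternionicSurface.immersedSet g)) := by
  constructor
  · rintro η hη g ⟨μ, hμ, hg⟩
    choose Ψ hΨ using hg
    obtain ⟨h1, h2, h3⟩ :=
      QuaternionicSurface.darboux_isConstrainedWillmoreOn hf hS hη hΨ hμ
    exact ⟨QuaternionicSurface.isOpen_immersedSet_of_darboux hf hS hη hΨ hμ, h1, _, _, h2, h3⟩
  · rintro ⟨-, S', hS', hc⟩ g ⟨μ, hμ, hg⟩
    choose Ψ hΨ using hg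
    obtain rfl := hS.unique hf hS'
    have hη := QuaternionicSurface.isLagrangeMultiplierOn_zero (f := f) hc
    obtain ⟨h1, h2, -⟩ :=
      QuaternionicSurface.darboux_isConstrainedWillmoreOn hf hS hη hΨ hμ
    exact ⟨QuaternionicSurface.isOpen_immersedSet_of_darboux hf hS hη hΨ hμ, h1, _, h2,
      QuaternionicSurface.darboux_isClosedFormOn hf hS hη hΨ hμ⟩
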